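/- Let $n \ge 1$ be an integer and let $\phi \in \{+,-\}$ be a sign (identified with $\pm 1$), with $\phi = +$ if $n$ is odd. Put $\mathcal I_n = \{-n+1, -n+3, \dots, n-1\}$ and, for $i \in \mathcal I_n$, let $\hat\imath = 0$ if $i \ge 0$ and $\hat\imath = 1$ if $i < 0$. Let $Y_n$ be the Yangian of $\mathfrak{gl}_n(\mathbb C)$: the associative unital $\mathbb C$-algebra with generators $T_{i,j}^{(r)}$ ($i,j \in \mathcal I_n$, $r \ge 1$) and relations $$[T_{i,j}^{(r+1)}, T_{k,l}^{(s)}] - [T_{i,j}^{(r)}, T_{k,l}^{(s+1)}] = T_{k,j}^{(r)} T_{i,l}^{(s)} - T_{k,j}^{(s)} T_{i,l}^{(r)} \qquad (i,j,k,l \in \mathcal I_n,\ r,s \ge 0),$$ where $T_{i,j}^{(0)} = \delta_{i,j}$. Put $T_{i,j}(u) = \sum_{r \ge 0} T_{i,j}^{(r)} u^{-r} \in Y_n[[u^{-1}]]$, let $\tau$ be the automorphism of $Y_n$ defined by $\tau(T_{i,j}(u)) = \phi^{\hat\imath+\hat\jmath}\, T_{-j,-i}(-u)$, and define $S_{i,j}^{(r)}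 \in Y_n$ by $$S_{i,j}(u) = \sum_{r \ge 0} S_{i,j}^{(r)} u^{-r} = \sum_{k \in \mathcal I_n} \tau(T_{i,k}(u))\, T_{k,j}(u).$$ The twisted Yangian $Y_n^\phi$ is the subalgebra of $Y_n$ generated by all $S_{i,j}^{(r)}$ with $i,j \in \mathcal I_n$ and $r \ge 1$. Call $(i,j,r)$ admissible if $i,j \in \mathcal I_n$, $r \ge 1$, and $$\begin{cases} i+j \le 0 & \text{if } \phi = + \text{ and } r \text{ is even, or } \phi = - \text{ and } r \text{ is odd;}\\ i+j < 0 & \text{if } \phi = + \text{ and } r \text{ is odd, or } \phi = - \text{ and } r \text{ is even.}\end{cases}$$ Fix an arbitrary total order on the set of admissible triples. Then the monomials in the elements $S_{i,j}^{(r)}$ with $(i,j,r)$ admissible, the factors of each monomial being taken in this order, form a basis of $Y_n^\phi$ over $\mathbb C$; distinct exponent functions (of finite support) give distinct monomials. -/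

import Mathlib

namespace TwistedYangian

/-- The index set `{-n+1, -n+3, …, n-1}` labelling rows and columns of `n × n` matrices. -/
def indexSet (n : ℕ) : Finset ℤ :=
  (Finset.range n).image fun k : ℕ => -(n : ℤ) + 1 + 2 * (k : ℤ)

/-- The type of elements of the index set. -/
abbrev Idx (n : ℕ) : Type := {i : ℤ // i ∈ indexSet n}

theorem neg_mem_indexSet {n : ℕ} {i : ℤ} (hi : i ∈ indexSet n) : -i ∈ indexSet n := by
  simp only [indexSet, Finset.mem_image, Finset.mem_range] at hi ⊢
  obtain ⟨k, hk, rfl⟩ := hi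
  exact ⟨n - 1 - k, by omega, by omega⟩

instance (n : ℕ) : Neg (Idx n) := ⟨fun i => ⟨-i.1, neg_mem_indexSet i.2⟩⟩

/-- `î`, equal to `0` if `i ≥ 0` and to `1` if `i < 0`. -/
def hat {n : ℕ} (i : Idx n) : ℕ := if 0 ≤ i.1 then 0 else 1

/-- The generator `T_{i,j}^{(r)}` of the free algebra for `r ≥ 1`,
with the convention `T_{i,j}^{(0)} = δ_{i,j}`. -/
noncomputable def freeT {n : ℕ} (i j : Idx n) (r : ℕ) :
    FreeAlgebra ℂ (Idx n × Idx n × ℕ+) :=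
  if h : 0 < r then FreeAlgebra.ι ℂ (i, j, ⟨r, h⟩) else if i = j then 1 else 0

/-- The defining relations of the Yangian of `𝔤𝔩_n`. -/
inductive YangianRel (n : ℕ) :
    FreeAlgebra ℂ (Idx n × Idx n × ℕ+) → FreeAlgebra ℂ (Idx n × Idx n × ℕ+) → Prop
  | mk (i j k l : Idx n) (r s : ℕ) : YangianRel n
      ((freeT i j (r + 1) * freeT k l s - freeT k l s * freeT i j (r + 1))
        - (freeT i j r * freeT k l (s + 1) - freeT k l (s + 1) * freeT i j r))
      (freeT k j r * freeT i l s - freeT k j s * freeT i l r)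

/-- The Yangian `Y_n` of `𝔤𝔩_n(ℂ)`. -/
abbrev Yangian (n : ℕ) : Type := RingQuot (YangianRel n)

/-- The element `T_{i,j}^{(r)}` of `Y_n`; it is `δ_{i,j}` for `r = 0`. -/
noncomputable def T {n : ℕ} (i j : Idx n) (r : ℕ) : Yangian n :=
  RingQuot.mkAlgHom ℂ (YangianRel n) (freeT i j r)

theorem T_zero {n : ℕ} (i j : Idx n) : T i j 0 = if i = j then 1 else 0 := by
  unfold T freeT
  rw [dif_neg (lt_irrefl 0)]
  split_ifs
  · exact map_one _
  · exact map_zero _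

theorem T_rel {n : ℕ} (i j k l : Idx n) (r s : ℕ) :
    (T i j (r + 1) * T k l s - T k l s * T i j (r + 1))
        - (T i j r * T k l (s + 1) - T k l (s + 1) * T i j r)
      = T k j r * T i l s - T k j s * T i l r := by
  have h := RingQuot.mkAlgHom_rel ℂ (YangianRel.mk i j k l r s)
  simpa only [map_sub, map_mul, T] using h

theorem T_comm_symm {n : ℕ} (i j k l : Idx n) (r s : ℕ) :
    T i j r * T k l s - T k l s * T i j r = T i j s * T k l r - T k l r * T i j s := by
  induction r generalizing s with
  | zero => rw [T_zero, T_zero]; split_ifs <;> simp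
  | succ r ih =>
    have h1 := T_rel i j k l r s
    have h2 := T_rel i j k l s r
    have h3 := ih (s + 1)
    rw [sub_eq_iff_eq_add] at h1 h2
    rw [h1, h3, h2]
    abel

/-- The values `φ^{î+ĵ} (-1)^r T_{-j,-i}^{(r)}` of the automorphism `τ` on generators. -/
noncomputable def tauT {n : ℕ} (φ : ℤˣ) (i j : Idx n) (r : ℕ) : Yangian n :=
  (((φ : ℤ) ^ (hat i + hat j) * (-1) ^ r : ℤ) : ℂ) • T (-j) (-i) r

theorem lift_freeT {n : ℕ} (φ : ℤˣ) (i j : Idx n) (r : ℕ) :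
    FreeAlgebra.lift ℂ (fun x : Idx n × Idx n × ℕ+ => tauT φ x.1 x.2.1 (x.2.2 : ℕ))
      (freeT i j r) = tauT φ i j r := by
  have hneg : (-j = -i) ↔ i = j := by
    constructor
    · intro h
      have h' : -j.1 = -i.1 := congrArg Subtype.val h
      exact Subtype.ext (by omega)
    · rintro rfl; rfl
  unfold freeT
  split_ifs with h h'
  · simp
  · obtain rfl : r = 0 := by omega
    subst h'
    simp [tauT, T_zero, pow_add, ← mul_pow]
  · obtain rfl : r = 0 := by omega
    simp [tauT, T_zero, hneg, h']

/-- The automorphism `τ` of `Y_n` given by `τ(T_{i,j}(u)) = φ^{î+ĵ} T_{-j,-i}(-u)`. -/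
noncomputable def tau (n : ℕ) (φ : ℤˣ) : Yangian n →ₐ[ℂ] Yangian n :=
  RingQuot.liftAlgHom ℂ
    ⟨FreeAlgebra.lift ℂ (fun x : Idx n × Idx n × ℕ+ => tauT φ x.1 x.2.1 (x.2.2 : ℕ)), by
      rintro _ _ ⟨i, j, k, l, r, s⟩
      simp only [map_sub, map_mul, lift_freeT]
      have h1 := T_rel (-j) (-i) (-l) (-k) r s
      have h2 := T_comm_symm (-j) (-k) (-l) (-i) r s
      have h3 : (T (-j) (-i) (r + 1) * T (-l) (-k) s - T (-l) (-k) s * T (-j) (-i) (r + 1))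
          - (T (-j) (-i) r * T (-l) (-k) (s + 1) - T (-l) (-k) (s + 1) * T (-j) (-i) r)
          = -(T (-j) (-k) r * T (-l) (-i) s - T (-j) (-k) s * T (-l) (-i) r) := by
        rw [h1]
        rw [sub_eq_iff_eq_add] at h2
        rw [h2]
        abel
      rw [sub_eq_iff_eq_add, sub_eq_iff_eq_add] at h3
      simp only [tauT, smul_mul_smul_comm, h3]
      push_cast
      module⟩

theorem tau_T {n : ℕ} (φ : ℤˣ) (i j : Idx n) (r : ℕ) :
    tau n φ (T i j r) =
      (((φ : ℤ) ^ (hat i + hat j) * (-1) ^ r : ℤ) : ℂ) • T (-j) (-i) r := by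
  unfold tau
  conv_lhs => rw [T, RingQuot.liftAlgHom_mkAlgHom_apply]
  exact lift_freeT φ i j r

/-- The power series `T_{i,j}(u) = ∑_{r ≥ 0} T_{i,j}^{(r)} u^{-r}` in the variable `u⁻¹`. -/
noncomputable def Tseries {n : ℕ} (i j : Idx n) : PowerSeries (Yangian n) :=
  PowerSeries.mk fun r => T i j r

/-- The power series `S_{i,j}(u) = ∑_k τ(T_{i,k}(u)) T_{k,j}(u)` in the variable `u⁻¹`. -/
noncomputable def Sseries {n : ℕ} (φ : ℤˣ) (i j : Idx n) : PowerSeries (Yangian n) :=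
  ∑ k : Idx n, PowerSeries.map (tau n φ : Yangian n →+* Yangian n) (Tseries i k) * Tseries k j

/-- The element `S_{i,j}^{(r)}`, the coefficient of `u^{-r}` in `S_{i,j}(u)`. -/
noncomputable def S {n : ℕ} (φ : ℤˣ) (i j : Idx n) (r : ℕ) : Yangian n :=
  PowerSeries.coeff r (Sseries φ i j)

/-- The twisted Yangian `Y_n^φ`: the subalgebra of `Y_n` generated by all `S_{i,j}^{(r)}`
with `r ≥ 1`. -/
noncomputable def twistedYangian (n : ℕ) (φ : ℤˣ) : Subalgebra ℂ (Yangian n) :=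
  Algebra.adjoin ℂ {x | ∃ (i j : Idx n) (r : ℕ), 1 ≤ r ∧ x = S φ i j r}

/-- Admissible triples `(i, j, r)`, with no upper bound on `r`. -/
structure AdmissibleTriple (n : ℕ) (φ : ℤˣ) where
  i : Idx n
  j : Idx n
  r : ℕ
  one_le : 1 ≤ r
  plus_even : φ = 1 → Even r → i.1 + j.1 ≤ 0
  plus_odd : φ = 1 → Odd r → i.1 + j.1 < 0
  minus_even : φ = -1 → Even r → i.1 + j.1 < 0
  minus_odd : φ = -1 → Odd r → i.1 + j.1 ≤ 0

/-- The monomial in the `S_{i,j}^{(r)}`, for admissible `(i, j, r)`, with exponents given by `m`,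
the factors being multiplied from left to right in increasing order of the triples. -/
noncomputable def orderedMonomial {n : ℕ} {φ : ℤˣ} [LinearOrder (AdmissibleTriple n φ)]
    (m : AdmissibleTriple n φ →₀ ℕ) : Yangian n :=
  ((m.support.sort (· ≤ ·)).map fun a => S φ a.i a.j a.r ^ m a).prod

end TwistedYangian

/-! Spanning and independence rest on two different filtrations.

Spanning. Write S(u) = T'(u) T(u) with T' = τ(T). The RTT relation in terms of Yang's R-matrix,
together with two mixed relations between T and T' in which the permutation is replaced by its
rank-one partial transpose (`mixed_matrix₁`, `mixed_matrix₂`), gives the equation `reflection` for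
S. Let S^{(r)} have weight r. The reflection equation then shows that commutators of generators of
weights r and s lie in weight at most r + s - 1 (`commutator_prodCoeff_mem`), so every product can
be sorted modulo lower weight (`filt_le_span_ordered`). The relation `prodCoeff_symm` expresses
S_{i,j}^{(r)} through S_{-j,-i}^{(r)} and S_{i,j}^{(r-1)}, so the admissible generators suffice
(`prodCoeff_mem_filt_admGen`).

Independence. No basis theorem for Y_n itself is needed. Let T^{(r+1)} have weight r. Modulo lower
weight T^{(r+1)} is primitive for the comultiplication T(u) ↦ T(u) ⊗ T(u), and S_{i,j}^{(r+1)} is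
T_{i,j}^{(r+1)} ± T_{-j,-i}^{(r+1)}, hence primitive as well. Evaluation T_{i,j}^{(r+1)} ↦ E_{i,j}
z^r yields linear maps ξ from Y_n to polynomials that kill 1, respect weights and take prescribed
leading coefficients on the generators (`exists_symbol`). In top degree the p-th convolution power
of ξ sends a product of p primitive elements to p! times the product of their symbols, and it kills
shorter products (`coeff_convPow`). When the symbols of the admissible generators are independent
variables, distinct ordered monomials are thereby separated (`linearIndependent_of_isPrim`). -/

namespace TwistedYangian

/-! ### RTT relations in an arbitrary algebra and the universal property of the Yangian -/

/-- A family of elements `t i j r` of an algebra satisfies the RTT relations. -/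
structure IsRTT {ι A : Type*} [DecidableEq ι] [Ring A] (t : ι → ι → ℕ → A) : Prop where
  zero : ∀ i j, t i j 0 = if i = j then 1 else 0
  rel : ∀ i j k l r s,
    (t i j (r + 1) * t k l s - t k l s * t i j (r + 1))
        - (t i j r * t k l (s + 1) - t k l (s + 1) * t i j r)
      = t k j r * t i l s - t k j s * t i l r

namespace IsRTT

variable {ι A : Type*} [DecidableEq ι] [Ring A] {t : ι → ι → ℕ → A}

theorem zero_commute (h : IsRTT t) (i j : ι) (a : A) : t i j 0 * a = a * t i j 0 := by
  rw [h.zero]; split_ifs <;> simp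

/-- The right-hand side of the RTT relation is antisymmetric under exchange of r and s, so its
contributions cancel when the relation is used once at (r, s) and once at (s, r). -/
theorem comm_symm (h : IsRTT t) (i j k l : ι) (r s : ℕ) :
    t i j r * t k l s - t k l s * t i j r = t i j s * t k l r - t k l r * t i j s := by
  induction r generalizing s with
  | zero => rw [h.zero_commute, h.zero_commute]; simp
  | succ r ih =>
    have h1 := h.rel i j k l r s
    have h2 := h.rel i j k l s r
    have h3 := ih (s + 1)
    rw [sub_eq_iff_eq_add] at h1 h2
    rw [h1, h3, h2]
    abel

/-- By `comm_symm` the factors on the right may be taken in the opposite order. This form is the one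
that survives transposition, which reverses products of matrix entries. -/
theorem rel' (h : IsRTT t) (i j k l : ι) (r s : ℕ) :
    (t i j (r + 1) * t k l s - t k l s * t i j (r + 1))
        - (t i j r * t k l (s + 1) - t k l (s + 1) * t i j r)
      = t i l s * t k j r - t i l r * t k j s := by
  rw [h.rel]
  have := h.comm_symm k j i l r s
  rw [sub_eq_iff_eq_add] at this
  rw [this]; abel

end IsRTT

theorem isRTT_T (n : ℕ) : IsRTT (T (n := n)) := ⟨T_zero, T_rel⟩

theorem IsRTT.map {ι A A' : Type*} [DecidableEq ι] [Ring A] [Ring A'] {t : ι → ι → ℕ → A}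
    (h : IsRTT t) (f : A →+* A') : IsRTT fun i j r => f (t i j r) where
  zero i j := by rw [h.zero]; split_ifs <;> simp
  rel i j k l r s := by simp only [← map_mul, ← map_sub, h.rel]

section Lift

variable {n : ℕ} {A : Type*} [Ring A] [Algebra ℂ A]

theorem lift_freeT_of_isRTT {t : Idx n → Idx n → ℕ → A} (h : IsRTT t) (i j : Idx n) (r : ℕ) :
    FreeAlgebra.lift ℂ (fun x : Idx n × Idx n × ℕ+ => t x.1 x.2.1 x.2.2) (freeT i j r)
      = t i j r := by
  unfold freeT
  split_ifs with h1 h2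
  · simp
  · obtain rfl : r = 0 := by omega
    simp [h.zero, h2]
  · obtain rfl : r = 0 := by omega
    simp [h.zero, h2]

/-- The homomorphism out of the Yangian given by a family satisfying the RTT relations. -/
noncomputable def yangianLift (t : Idx n → Idx n → ℕ → A) (h : IsRTT t) : Yangian n →ₐ[ℂ] A :=
  RingQuot.liftAlgHom ℂ
    ⟨FreeAlgebra.lift ℂ (fun x : Idx n × Idx n × ℕ+ => t x.1 x.2.1 x.2.2), by
      rintro _ _ ⟨i, j, k, l, r, s⟩
      simp only [map_sub, map_mul, lift_freeT_of_isRTT h, h.rel]⟩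

theorem yangianLift_T (t : Idx n → Idx n → ℕ → A) (h : IsRTT t) (i j : Idx n) (r : ℕ) :
    yangianLift t h (T i j r) = t i j r := by
  unfold yangianLift
  conv_lhs => rw [T, RingQuot.liftAlgHom_mkAlgHom_apply]
  exact lift_freeT_of_isRTT h i j r

end Lift

/-! ### Generating series in x = u⁻¹ and y = v⁻¹ -/

section TwoVariables

/-- Power series in two central variables over a (noncommutative) ring. -/
abbrev Series₂ (A : Type*) [Ring A] : Type _ := PowerSeries (PowerSeries A)

namespace Series₂

variable {A : Type*} [Ring A]

/-- The first variable. -/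
noncomputable def x : Series₂ A := PowerSeries.C PowerSeries.X
/-- The second variable. -/
noncomputable def y : Series₂ A := PowerSeries.X
/-- Regard a series in one variable as a series in the first variable. -/
noncomputable def inX : PowerSeries A →+* Series₂ A := PowerSeries.C
/-- Regard a series in one variable as a series in the second variable. -/
noncomputable def inY : PowerSeries A →+* Series₂ A := PowerSeries.map PowerSeries.C
/-- The coefficient of `x ^ r * y ^ s`. -/
noncomputable def cf (r s : ℕ) : Series₂ A →+ A :=
  (PowerSeries.coeff r).toAddMonoidHom.comp (PowerSeries.coeff s).toAddMonoidHom

theorem cf_apply (r s : ℕ) (f : Series₂ A) :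
    cf r s f = PowerSeries.coeff r (PowerSeries.coeff s f) := rfl

theorem ext_cf {f g : Series₂ A} (h : ∀ r s, cf r s f = cf r s g) : f = g :=
  PowerSeries.ext fun s => PowerSeries.ext fun r => h r s

theorem y_commute (f : Series₂ A) : Commute y f := (PowerSeries.commute_X f).symm

theorem x_commute (f : Series₂ A) : Commute x f := by
  refine PowerSeries.ext fun s => ?_
  rw [x, PowerSeries.coeff_C_mul, PowerSeries.coeff_mul_C, PowerSeries.X_mul]

@[simp] theorem cf_inX_mul_inY (f g : PowerSeries A) (r s : ℕ) :
    cf r s (inX f * inY g) = PowerSeries.coeff r f * PowerSeries.coeff s g := by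
  rw [cf_apply, inX, inY, PowerSeries.coeff_C_mul, PowerSeries.coeff_map, PowerSeries.coeff_mul_C]

@[simp] theorem cf_inY_mul_inX (f g : PowerSeries A) (r s : ℕ) :
    cf r s (inY g * inX f) = PowerSeries.coeff s g * PowerSeries.coeff r f := by
  rw [cf_apply, inX, inY, PowerSeries.coeff_mul_C, PowerSeries.coeff_map, PowerSeries.coeff_C_mul]

@[simp] theorem cf_x_mul_succ (f : Series₂ A) (r s : ℕ) : cf (r + 1) s (x * f) = cf r s f := by
  rw [cf_apply, x, PowerSeries.coeff_C_mul, PowerSeries.coeff_succ_X_mul]; rfl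

@[simp] theorem cf_x_mul_zero (f : Series₂ A) (s : ℕ) : cf 0 s (x * f) = 0 := by
  rw [cf_apply, x, PowerSeries.coeff_C_mul, PowerSeries.coeff_zero_X_mul]

@[simp] theorem cf_y_mul_succ (f : Series₂ A) (r s : ℕ) : cf r (s + 1) (y * f) = cf r s f := by
  rw [cf_apply, y, PowerSeries.coeff_succ_X_mul]; rfl

@[simp] theorem cf_y_mul_zero (f : Series₂ A) (r : ℕ) : cf r 0 (y * f) = 0 := by
  rw [cf_apply, y, PowerSeries.coeff_zero_X_mul, map_zero]

theorem cf_mul (f g : Series₂ A) (r s : ℕ) :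
    cf r s (f * g) = ∑ p ∈ Finset.HasAntidiagonal.antidiagonal s, ∑ q ∈ Finset.HasAntidiagonal.antidiagonal r,
      cf q.1 p.1 f * cf q.2 p.2 g := by
  simp only [cf_apply, PowerSeries.coeff_mul, map_sum]

end Series₂

end TwoVariables

set_option linter.unusedSectionVars false

/-! ### The RTT relation in R-matrix form -/

section Matrices

open Series₂ Matrix

variable {ι A : Type*} [DecidableEq ι] [Fintype ι] [Ring A]

/-- The generating series `∑ t i j r u⁻ʳ`, arranged in a matrix. -/
noncomputable def genMatrix (t : ι → ι → ℕ → A) : Matrix ι ι (PowerSeries A) :=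
  Matrix.of fun i j => PowerSeries.mk (t i j)

@[simp] theorem coeff_genMatrix (t : ι → ι → ℕ → A) (i j : ι) (r : ℕ) :
    PowerSeries.coeff r (genMatrix t i j) = t i j r := by simp [genMatrix]

/-- `M ⊗ 1`. -/
def leg₁ {B : Type*} [Zero B] (M : Matrix ι ι B) : Matrix (ι × ι) (ι × ι) B :=
  Matrix.of fun p q => if p.2 = q.2 then M p.1 q.1 else 0

/-- `1 ⊗ M`. -/
def leg₂ {B : Type*} [Zero B] (M : Matrix ι ι B) : Matrix (ι × ι) (ι × ι) B :=
  Matrix.of fun p q => if p.1 = q.1 then M p.2 q.2 else 0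

/-- The permutation matrix on the tensor square. -/
def swapMatrix (ι B : Type*) [DecidableEq ι] [Zero B] [One B] : Matrix (ι × ι) (ι × ι) B :=
  Matrix.of fun p q => if p.swap = q then 1 else 0

section Legs

variable {B : Type*} [Ring B]

theorem leg₁_mul (M N : Matrix ι ι B) : leg₁ (M * N) = leg₁ M * leg₁ N := by
  ext ⟨i, k⟩ ⟨j, l⟩
  simp only [leg₁, Matrix.mul_apply, Matrix.of_apply, Fintype.sum_prod_type]
  by_cases h : k = l
  · simp [h]
  · simp [h]

theorem leg₂_mul (M N : Matrix ι ι B) : leg₂ (M * N) = leg₂ M * leg₂ N := by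
  ext ⟨i, k⟩ ⟨j, l⟩
  simp only [leg₂, Matrix.mul_apply, Matrix.of_apply, Fintype.sum_prod_type]
  by_cases h : i = j
  · simp [h]
  · simp [h]

theorem leg₁_mul_leg₂_apply (M N : Matrix ι ι B) (p q : ι × ι) :
    (leg₁ M * leg₂ N) p q = M p.1 q.1 * N p.2 q.2 := by
  simp [leg₁, leg₂, Matrix.mul_apply, Fintype.sum_prod_type]

theorem leg₂_mul_leg₁_apply (M N : Matrix ι ι B) (p q : ι × ι) :
    (leg₂ N * leg₁ M) p q = N p.2 q.2 * M p.1 q.1 := by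
  simp [leg₁, leg₂, Matrix.mul_apply, Fintype.sum_prod_type]

theorem swapMatrix_mul_apply (M : Matrix (ι × ι) (ι × ι) B) (p q : ι × ι) :
    (swapMatrix ι B * M) p q = M p.swap q := by
  simp [swapMatrix, Matrix.mul_apply]

theorem mul_swapMatrix_apply (M : Matrix (ι × ι) (ι × ι) B) (p q : ι × ι) :
    (M * swapMatrix ι B) p q = M p q.swap := by
  have h : ∀ a : ι × ι, (a.swap = q) = (a = q.swap) := fun a => by
    rw [← Prod.swap_inj, Prod.swap_swap]
  simp [swapMatrix, Matrix.mul_apply, h]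

theorem scalar_mul_apply' (b : B) (M : Matrix (ι × ι) (ι × ι) B) (p q : ι × ι) :
    (Matrix.scalar (ι × ι) b * M) p q = b * M p q := by
  simp [Matrix.scalar_apply]

end Legs

/-- The scalar matrix `x`. -/
noncomputable def matX (ι A : Type*) [DecidableEq ι] [Fintype ι] [Ring A] :
    Matrix (ι × ι) (ι × ι) (Series₂ A) := Matrix.scalar (ι × ι) x

/-- The scalar matrix `y`. -/
noncomputable def matY (ι A : Type*) [DecidableEq ι] [Fintype ι] [Ring A] :
    Matrix (ι × ι) (ι × ι) (Series₂ A) := Matrix.scalar (ι × ι) y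

theorem matX_commute (M : Matrix (ι × ι) (ι × ι) (Series₂ A)) : Commute (matX ι A) M :=
  Matrix.scalar_commute _ x_commute M

theorem matY_commute (M : Matrix (ι × ι) (ι × ι) (Series₂ A)) : Commute (matY ι A) M :=
  Matrix.scalar_commute _ y_commute M

/-- Yang's `R`-matrix, in the variables `x = u⁻¹` and `y = v⁻¹`. -/
noncomputable def rMatrix (ι A : Type*) [DecidableEq ι] [Fintype ι] [Ring A] :
    Matrix (ι × ι) (ι × ι) (Series₂ A) :=
  (matY ι A - matX ι A) - matX ι A * matY ι A * swapMatrix ι (Series₂ A)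

/-- The coefficient of x^{r+1} y^{s+1} is the RTT relation at (r, s). When either exponent is 0,
only commutators with the central elements t^{(0)} occur, and both sides vanish. -/
theorem isRTT_series {t : ι → ι → ℕ → A} (h : IsRTT t) (i j k l : ι) :
    (y - x) * (inX (genMatrix t i j) * inY (genMatrix t k l)
        - inY (genMatrix t k l) * inX (genMatrix t i j))
      = x * (y * (inX (genMatrix t k j) * inY (genMatrix t i l)
        - inY (genMatrix t k j) * inX (genMatrix t i l))) := by
  refine ext_cf fun r s => ?_
  rcases r with _ | r <;> rcases s with _ | s <;>
    simp [sub_mul, h.zero_commute, ← h.rel i j k l]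

theorem rMatrix_mul_leg_apply (t : ι → ι → ℕ → A) (i j k l : ι) :
    (rMatrix ι A * leg₁ ((genMatrix t).map inX) * leg₂ ((genMatrix t).map inY)
      - leg₂ ((genMatrix t).map inY) * leg₁ ((genMatrix t).map inX) * rMatrix ι A) (i, k) (j, l) =
    (y - x) * (inX (genMatrix t i j) * inY (genMatrix t k l)
        - inY (genMatrix t k l) * inX (genMatrix t i j))
      - x * (y * (inX (genMatrix t k j) * inY (genMatrix t i l)
        - inY (genMatrix t k j) * inX (genMatrix t i l))) := by
  set T₁ := leg₁ ((genMatrix t).map inX)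
  set T₂ := leg₂ ((genMatrix t).map inY)
  have e : rMatrix ι A * T₁ * T₂ - T₂ * T₁ * rMatrix ι A
      = matY ι A * (T₁ * T₂ - T₂ * T₁) - matX ι A * (T₁ * T₂ - T₂ * T₁)
        - matX ι A * (matY ι A * (swapMatrix ι _ * (T₁ * T₂) - T₂ * T₁ * swapMatrix ι _)) := by
    rw [rMatrix, mul_sub (T₂ * T₁), mul_sub (T₂ * T₁), ← (matX_commute (T₂ * T₁)).eq,
      ← (matY_commute (T₂ * T₁)).eq, mul_assoc (matX ι A), ← mul_assoc (T₂ * T₁) (matX ι A),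
      ← (matX_commute (T₂ * T₁)).eq, mul_assoc (matX ι A), ← mul_assoc (T₂ * T₁) (matY ι A),
      ← (matY_commute (T₂ * T₁)).eq]
    noncomm_ring
  rw [e]
  simp only [Matrix.sub_apply, matX, matY, scalar_mul_apply', swapMatrix_mul_apply,
    mul_swapMatrix_apply, T₁, T₂, leg₁_mul_leg₂_apply, leg₂_mul_leg₁_apply, Matrix.map_apply,
    Prod.swap_prod_mk, sub_mul]

/-- Clearing denominators in Yang's matrix gives xy((u - v) - P) = (y - x) - xyP. In this form
products of solutions are handled by moving R past the legs. -/
theorem isRTT_iff_matrix {t : ι → ι → ℕ → A} (h0 : ∀ i j, t i j 0 = if i = j then 1 else 0) :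
    IsRTT t ↔ rMatrix ι A * leg₁ ((genMatrix t).map inX) * leg₂ ((genMatrix t).map inY)
      = leg₂ ((genMatrix t).map inY) * leg₁ ((genMatrix t).map inX) * rMatrix ι A := by
  constructor
  · intro h
    rw [← sub_eq_zero]
    ext ⟨i, k⟩ ⟨j, l⟩ : 2
    rw [rMatrix_mul_leg_apply, isRTT_series h, sub_self, Matrix.zero_apply]
  · intro h
    refine ⟨h0, fun i j k l r s => ?_⟩
    have e := rMatrix_mul_leg_apply t i j k l
    rw [h, sub_self, Matrix.zero_apply, eq_comm, sub_eq_zero] at e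
    have e' := congrArg (cf (r + 1) (s + 1)) e
    simpa [sub_mul] using e'

/-- The product of two commuting solutions of the RTT relations is again a solution. -/
theorem IsRTT.mul {t t' : ι → ι → ℕ → A} (h : IsRTT t) (h' : IsRTT t')
    (hc : ∀ i j k l r s, t i j r * t' k l s = t' k l s * t i j r) :
    IsRTT fun i j r => ∑ k, ∑ p ∈ Finset.HasAntidiagonal.antidiagonal r, t i k p.1 * t' k j p.2 := by
  have hg : genMatrix (fun i j r => ∑ k, ∑ p ∈ Finset.HasAntidiagonal.antidiagonal r, t i k p.1 * t' k j p.2)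
      = genMatrix t * genMatrix t' := by
    ext i j r
    simp [Matrix.mul_apply, PowerSeries.coeff_mul]
  have hc1 : leg₁ ((genMatrix t').map inX) * leg₂ ((genMatrix t).map inY)
      = leg₂ ((genMatrix t).map inY) * leg₁ ((genMatrix t').map inX) := by
    refine Matrix.ext fun p q => ?_
    rw [leg₁_mul_leg₂_apply, leg₂_mul_leg₁_apply]
    exact ext_cf fun r s => by simp [hc]
  have hc2 : leg₁ ((genMatrix t).map inX) * leg₂ ((genMatrix t').map inY)
      = leg₂ ((genMatrix t').map inY) * leg₁ ((genMatrix t).map inX) := by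
    refine Matrix.ext fun p q => ?_
    rw [leg₁_mul_leg₂_apply, leg₂_mul_leg₁_apply]
    exact ext_cf fun r s => by simp [hc]
  rw [isRTT_iff_matrix]
  · rw [isRTT_iff_matrix h.zero] at h
    rw [isRTT_iff_matrix h'.zero] at h'
    rw [hg, Matrix.map_mul, Matrix.map_mul, leg₁_mul, leg₂_mul]
    generalize leg₁ ((genMatrix t).map inX) = a, leg₂ ((genMatrix t).map inY) = b,
      leg₁ ((genMatrix t').map inX) = a', leg₂ ((genMatrix t').map inY) = b' at *
    calc rMatrix ι A * (a * a') * (b * b') = rMatrix ι A * a * (a' * b) * b' := by noncomm_ring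
      _ = (rMatrix ι A * a * b) * a' * b' := by rw [hc1]; noncomm_ring
      _ = b * a * (rMatrix ι A * a' * b') := by rw [h]; noncomm_ring
      _ = b * (a * b') * a' * rMatrix ι A := by rw [h']; noncomm_ring
      _ = _ := by rw [hc2]; noncomm_ring
  · intro i j
    simp [h.zero, h'.zero]

end Matrices

end TwistedYangian

namespace TwistedYangian

open Series₂ Matrix

instance {n : ℕ} : InvolutiveNeg (Idx n) where
  neg_neg i := Subtype.ext (neg_neg i.1)

/-! ### Signs of the twisted transposition -/

section Sign

variable {n : ℕ}

/-- The sign `φ ^ î`. -/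
def eps (φ : ℤˣ) (i : Idx n) : ℤ := (φ : ℤ) ^ hat i

theorem eps_mul_self (φ : ℤˣ) (i : Idx n) : eps φ i * eps φ i = 1 := by
  rw [eps, ← mul_pow, ← Units.val_mul, Int.units_mul_self]; simp

theorem odd_of_val_eq_zero {i : Idx n} (h : i.1 = 0) : Odd n := by
  have := i.2
  rw [h, indexSet] at this
  simp only [Finset.mem_image, Finset.mem_range] at this
  obtain ⟨k, -, hk⟩ := this
  exact ⟨k, by omega⟩

theorem neg_val (i : Idx n) : (-i).1 = -i.1 := rfl

/-- The index 0 equals its own negative, so the formula would fail there for φ = -1; index 0 occurs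
only for odd n, where φ = 1. -/
theorem eps_neg {φ : ℤˣ} (hφ : Odd n → φ = 1) (i : Idx n) : eps φ (-i) = φ * eps φ i := by
  rcases Int.units_eq_one_or φ with rfl | rfl
  · simp [eps]
  · have h0 : i.1 ≠ 0 := fun h => by simpa using hφ (odd_of_val_eq_zero h)
    simp only [eps, hat, neg_val]
    rcases lt_or_gt_of_ne h0 with h | h
    · rw [if_pos (by omega), if_neg (by omega)]; simp
    · rw [if_neg (by omega), if_pos (by omega)]; simp

theorem units_mul_self (φ : ℤˣ) : (φ : ℤ) * φ = 1 := by
  rw [← Units.val_mul, Int.units_mul_self]; rfl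

theorem tauT_eq (φ : ℤˣ) (i j : Idx n) (r : ℕ) :
    tauT φ i j r = ((eps φ i * eps φ j * (-1) ^ r : ℤ) : Yangian n) * T (-j) (-i) r := by
  rw [tauT, Algebra.smul_def, map_intCast, pow_add]; rfl

theorem isRTT_tauT (φ : ℤˣ) : IsRTT (tauT (n := n) φ) := by
  have h := (isRTT_T n).map (tau n φ : Yangian n →+* Yangian n)
  have e : tauT (n := n) φ = fun i j r => (tau n φ : Yangian n →+* Yangian n) (T i j r) := by
    funext i j r
    exact (tau_T φ i j r).symm
  rwa [e]

end Sign

/-! ### Mixed relations and the reflection equation -/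

section Mixed

variable {n : ℕ} {A : Type*} [Ring A]

/-- The family `t'` is the twisted transpose `φ^{î+ĵ} t_{-j,-i}(-u)` of `t`, and also satisfies
the RTT relations. -/
structure IsTwistedTranspose (φ : ℤˣ) (t t' : Idx n → Idx n → ℕ → A) : Prop where
  isRTT : IsRTT t'
  eq_cast_mul : ∀ i j r, t' i j r = ((eps φ i * eps φ j * (-1) ^ r : ℤ) : A) * t (-j) (-i) r

theorem IsTwistedTranspose.eq {φ : ℤˣ} {t t' : Idx n → Idx n → ℕ → A}
    (h : IsTwistedTranspose φ t t') (i j : Idx n) (r : ℕ) :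
    t' i j r = (eps φ i * eps φ j * (-1) ^ r) • t (-j) (-i) r := by
  rw [h.eq_cast_mul, zsmul_eq_mul]

theorem isTwistedTranspose_tauT (φ : ℤˣ) : IsTwistedTranspose φ (T (n := n)) (tauT φ) :=
  ⟨isRTT_tauT φ, tauT_eq φ⟩

variable {t t' : Idx n → Idx n → ℕ → A}

/-- This is `rel'` at (i, j, -l, -k): passing to the twisted transpose in the second factor replaces
v by -v, which turns y - x into x + y up to sign. -/
theorem mixed_series₁ {φ : ℤˣ} (h0 : IsRTT t) (ht' : IsTwistedTranspose φ t t') (i j k l : Idx n) :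
    (x + y) * (inX (genMatrix t i j) * inY (genMatrix t' k l)
        - inY (genMatrix t' k l) * inX (genMatrix t i j))
      = x * (y * ((eps φ (-i) * eps φ l) •
            (inY (genMatrix t' k (-i)) * inX (genMatrix t (-l) j))
          - (eps φ k * eps φ (-j)) •
            (inX (genMatrix t i (-k)) * inY (genMatrix t' (-j) l)))) := by
  refine ext_cf fun r s => ?_
  rcases r with _ | r <;> rcases s with _ | s
  · simp [add_mul]
  · simp [add_mul, h0.zero_commute]
  · simp [add_mul, ht'.isRTT.zero_commute]
  · have h := h0.rel' i j (-l) (-k) r s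
    have e1 : eps φ (-i) * eps φ l * (eps φ k * eps φ (-i) * (-1) ^ s)
        = eps φ k * eps φ l * (-1) ^ s := by
      linear_combination (eps φ k * eps φ l * (-1) ^ s) * eps_mul_self φ (-i)
    have e2 : eps φ k * eps φ (-j) * (eps φ (-j) * eps φ l * (-1) ^ s)
        = eps φ k * eps φ l * (-1) ^ s := by
      linear_combination (eps φ k * eps φ l * (-1) ^ s) * eps_mul_self φ (-j)
    simp only [add_mul, map_add, map_sub, map_zsmul, mul_sub, cf_x_mul_succ, cf_y_mul_succ,
      cf_inX_mul_inY, cf_inY_mul_inX, coeff_genMatrix, ht'.eq, mul_smul_comm, smul_mul_assoc,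
      smul_smul, e1, e2, neg_neg, pow_succ]
    linear_combination (norm := module) (eps φ k * eps φ l * (-1) ^ s) • h

/-- Here the twisted transpose sits in the first factor. The signs at k and -k now meet, so
`eps_neg` is needed. -/
theorem mixed_series₂ {φ : ℤˣ} (hφ : Odd n → φ = 1) (h0 : IsRTT t)
    (ht' : IsTwistedTranspose φ t t') (i j k l : Idx n) :
    (x + y) * (inY (genMatrix t k l) * inX (genMatrix t' i j)
        - inX (genMatrix t' i j) * inY (genMatrix t k l))
      = x * (y * ((eps φ k * eps φ (-j)) •
            (inX (genMatrix t' i (-k)) * inY (genMatrix t (-j) l))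
          - (eps φ (-i) * eps φ l) •
            (inY (genMatrix t k (-i)) * inX (genMatrix t' (-l) j)))) := by
  refine ext_cf fun r s => ?_
  rcases r with _ | r <;> rcases s with _ | s
  · simp [add_mul]
  · simp [add_mul, ht'.isRTT.zero_commute]
  · simp [add_mul, h0.zero_commute]
  · have h := h0.rel' k l (-j) (-i) s r
    have e1 : eps φ k * eps φ (-j) * (eps φ i * eps φ (-k) * (-1) ^ r)
        = eps φ i * eps φ j * (-1) ^ r := by
      rw [eps_neg hφ, eps_neg hφ]
      linear_combination (eps φ i * eps φ j * (-1) ^ r) * (eps_mul_self φ k * φ * φ +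
        units_mul_self φ)
    have e2 : eps φ (-i) * eps φ l * (eps φ (-l) * eps φ j * (-1) ^ r)
        = eps φ i * eps φ j * (-1) ^ r := by
      rw [eps_neg hφ, eps_neg hφ]
      linear_combination (eps φ i * eps φ j * (-1) ^ r) * (eps_mul_self φ l * φ * φ +
        units_mul_self φ)
    simp only [add_mul, map_add, map_sub, map_zsmul, mul_sub, cf_x_mul_succ, cf_y_mul_succ,
      cf_inX_mul_inY, cf_inY_mul_inX, coeff_genMatrix, ht'.eq, mul_smul_comm, smul_mul_assoc,
      smul_smul, e1, e2, neg_neg, pow_succ]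
    linear_combination (norm := module) (eps φ i * eps φ j * (-1) ^ r) • h

/-- The vector spanning the image of the partially transposed permutation matrix. -/
def qVec (n : ℕ) (φ : ℤˣ) (B : Type*) [Ring B] (p : Idx n × Idx n) : B :=
  if p.1 = -p.2 then ((eps φ p.2 : ℤ) : B) else 0

/-- The partial transpose of the permutation matrix. -/
def qMatrix (n : ℕ) (φ : ℤˣ) (B : Type*) [Ring B] : Matrix (Idx n × Idx n) (Idx n × Idx n) B :=
  Matrix.vecMulVec (qVec n φ B) (qVec n φ B)

variable {B : Type*} [Ring B]

/-- Since Q is a column times a row, the product splits into a column determined by N and a row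
determined by N'. -/
theorem leg₁_mul_qMatrix_mul_leg₂ (φ : ℤˣ) (N N' : Matrix (Idx n) (Idx n) B) (i j k l : Idx n) :
    (leg₁ N * qMatrix n φ B * leg₂ N') (i, k) (j, l)
      = (eps φ k * eps φ (-j)) • (N i (-k) * N' (-j) l) := by
  rw [qMatrix, Matrix.mul_vecMulVec, Matrix.vecMulVec_mul, Matrix.vecMulVec_apply]
  have h1 : (leg₁ N *ᵥ qVec n φ B) (i, k) = N i (-k) * ((eps φ k : ℤ) : B) := by
    simp only [Matrix.mulVec, dotProduct, leg₁, qVec, Fintype.sum_prod_type]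
    rw [Finset.sum_comm]
    simp [-Finset.univ_eq_attach]
  have h2 : (qVec n φ B ᵥ* leg₂ N') (j, l) = ((eps φ (-j) : ℤ) : B) * N' (-j) l := by
    have : ∀ k' : Idx n, (j = -k') = (k' = -j) := fun k' => by
      exact propext ⟨by rintro rfl; rw [neg_neg], by rintro rfl; rw [neg_neg]⟩
    simp [-Finset.univ_eq_attach, Matrix.vecMul, dotProduct, leg₂, qVec, Fintype.sum_prod_type, this]
  rw [h1, h2, zsmul_eq_mul, Int.cast_mul, ← (Int.cast_commute (eps φ k) (N i (-k))).eq,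
    mul_assoc, ← mul_assoc (N i (-k)), ← (Int.cast_commute (eps φ (-j)) (N i (-k))).eq]
  simp only [mul_assoc]

theorem leg₂_mul_qMatrix_mul_leg₁ (φ : ℤˣ) (N N' : Matrix (Idx n) (Idx n) B) (i j k l : Idx n) :
    (leg₂ N' * qMatrix n φ B * leg₁ N) (i, k) (j, l)
      = (eps φ (-i) * eps φ l) • (N' k (-i) * N (-l) j) := by
  rw [qMatrix, Matrix.mul_vecMulVec, Matrix.vecMulVec_mul, Matrix.vecMulVec_apply]
  have h1 : (leg₂ N' *ᵥ qVec n φ B) (i, k) = N' k (-i) * ((eps φ (-i) : ℤ) : B) := by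
    have : ∀ k' : Idx n, (i = -k') = (k' = -i) := fun k' => by
      exact propext ⟨by rintro rfl; rw [neg_neg], by rintro rfl; rw [neg_neg]⟩
    simp only [Matrix.mulVec, dotProduct, leg₂, qVec, Fintype.sum_prod_type]
    rw [Finset.sum_comm]
    simp [-Finset.univ_eq_attach, this]
  have h2 : (qVec n φ B ᵥ* leg₁ N) (j, l) = ((eps φ l : ℤ) : B) * N (-l) j := by
    simp [-Finset.univ_eq_attach, Matrix.vecMul, dotProduct, leg₁, qVec, Fintype.sum_prod_type]
  rw [h1, h2, zsmul_eq_mul, Int.cast_mul, ← (Int.cast_commute (eps φ (-i)) (N' k (-i))).eq,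
    mul_assoc, ← mul_assoc (N' k (-i)), ← (Int.cast_commute (eps φ l) (N' k (-i))).eq]
  simp only [mul_assoc]

/-- The vector spanning the image of Q is an eigenvector of the swap with eigenvalue φ, so both
products equal φ Q. -/
theorem swapMatrix_mul_qMatrix {φ : ℤˣ} (hφ : Odd n → φ = 1) :
    swapMatrix (Idx n) B * qMatrix n φ B = qMatrix n φ B * swapMatrix (Idx n) B := by
  refine Matrix.ext fun p q => ?_
  have h : ∀ p : Idx n × Idx n, qVec n φ B p.swap = ((φ : ℤ) : B) * qVec n φ B p := by
    rintro ⟨i, k⟩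
    simp only [qVec, Prod.swap]
    by_cases h : i = -k
    · subst h
      rw [if_pos (neg_neg k).symm, if_pos rfl, eps_neg hφ, Int.cast_mul]
    · rw [if_neg h, if_neg (fun h' => h (by rw [h', neg_neg])), mul_zero]
  rw [swapMatrix_mul_apply, mul_swapMatrix_apply, qMatrix, Matrix.vecMulVec_apply,
    Matrix.vecMulVec_apply, h, h, ← mul_assoc, (Int.cast_commute (φ : ℤ) (qVec n φ B p)).eq]

/-- The partially transposed `R`-matrix. -/
noncomputable def mMatrix (n : ℕ) (φ : ℤˣ) (A : Type*) [Ring A] :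
    Matrix (Idx n × Idx n) (Idx n × Idx n) (Series₂ (A)) :=
  (matX (Idx n) (A) + matY (Idx n) (A))
    + matX (Idx n) (A) * matY (Idx n) (A) * qMatrix n φ _

theorem mul_mMatrix_mul (φ : ℤˣ)
    (N N' : Matrix (Idx n × Idx n) (Idx n × Idx n) (Series₂ (A))) :
    N * mMatrix n φ A * N' = matX _ _ * (N * N') + matY _ _ * (N * N')
      + matX _ _ * (matY _ _ * (N * qMatrix n φ _ * N')) := by
  rw [mMatrix, mul_add, mul_add, ← (matX_commute N).eq, ← (matY_commute N).eq, mul_assoc (matX _ _),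
    ← mul_assoc N, ← (matX_commute N).eq, mul_assoc (matX _ _), ← mul_assoc N,
    ← (matY_commute N).eq]
  noncomm_ring

theorem mixed_matrix₁ {φ : ℤˣ} (h0 : IsRTT t) (ht' : IsTwistedTranspose φ t t') :
    leg₁ ((genMatrix t).map inX) * mMatrix n φ A * leg₂ ((genMatrix t').map inY)
      = leg₂ ((genMatrix t').map inY) * mMatrix n φ A * leg₁ ((genMatrix t).map inX) := by
  refine Matrix.ext ?_
  rintro ⟨i, k⟩ ⟨j, l⟩
  have h := mixed_series₁ h0 ht' i j k l
  simp only [mul_mMatrix_mul, Matrix.add_apply, matX, matY, scalar_mul_apply',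
    leg₁_mul_qMatrix_mul_leg₂, leg₂_mul_qMatrix_mul_leg₁, leg₁_mul_leg₂_apply,
    leg₂_mul_leg₁_apply, Matrix.map_apply]
  simp only [add_mul, mul_sub] at h
  rw [← sub_eq_zero] at h ⊢
  rw [← h]
  abel

theorem mixed_matrix₂ {φ : ℤˣ} (hφ : Odd n → φ = 1) (h0 : IsRTT t)
    (ht' : IsTwistedTranspose φ t t') :
    leg₂ ((genMatrix t).map inY) * mMatrix n φ A * leg₁ ((genMatrix t').map inX)
      = leg₁ ((genMatrix t').map inX) * mMatrix n φ A * leg₂ ((genMatrix t).map inY) := by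
  refine Matrix.ext ?_
  rintro ⟨i, k⟩ ⟨j, l⟩
  have h := mixed_series₂ hφ h0 ht' i j k l
  simp only [mul_mMatrix_mul, Matrix.add_apply, matX, matY, scalar_mul_apply',
    leg₁_mul_qMatrix_mul_leg₂, leg₂_mul_qMatrix_mul_leg₁, leg₁_mul_leg₂_apply,
    leg₂_mul_leg₁_apply, Matrix.map_apply]
  simp only [add_mul, mul_sub] at h
  rw [← sub_eq_zero] at h ⊢
  rw [← h]
  abel

theorem rMatrix_mul_mMatrix {φ : ℤˣ} (hφ : Odd n → φ = 1) :
    rMatrix (Idx n) (A) * mMatrix n φ A = mMatrix n φ A * rMatrix (Idx n) (A) := by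
  have hx := matX_commute (ι := Idx n) (A := A)
  have hy := matY_commute (ι := Idx n) (A := A)
  have hpq : Commute (swapMatrix (Idx n) (Series₂ (A))) (qMatrix n φ _) :=
    swapMatrix_mul_qMatrix hφ
  rw [rMatrix, mMatrix]
  refine Commute.sub_left ((hy _).sub_left (hx _)) (((hx _).mul_left (hy _)).mul_left ?_)
  exact ((hx _).symm.add_right (hy _).symm).add_right
    (((hx _).symm.mul_right (hy _).symm).mul_right hpq)

/-- The reflection equation. -/
theorem reflection {φ : ℤˣ} (hφ : Odd n → φ = 1) (h0 : IsRTT t)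
    (ht' : IsTwistedTranspose φ t t') :
    rMatrix (Idx n) A * leg₁ ((genMatrix t' * genMatrix t).map inX) * mMatrix n φ A
        * leg₂ ((genMatrix t' * genMatrix t).map inY)
      = leg₂ ((genMatrix t' * genMatrix t).map inY) * mMatrix n φ A
        * leg₁ ((genMatrix t' * genMatrix t).map inX) * rMatrix (Idx n) A := by
  have h1 := (isRTT_iff_matrix h0.zero).1 h0
  have h2 := (isRTT_iff_matrix ht'.isRTT.zero).1 ht'.isRTT
  have h3 := mixed_matrix₁ h0 ht'
  have h4 := mixed_matrix₂ hφ h0 ht'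
  have h5 := rMatrix_mul_mMatrix (A := A) hφ
  rw [Matrix.map_mul, Matrix.map_mul, leg₁_mul, leg₂_mul]
  generalize leg₁ ((genMatrix t).map inX) = a, leg₂ ((genMatrix t).map inY) = b,
    leg₁ ((genMatrix t').map inX) = c, leg₂ ((genMatrix t').map inY) = d,
    rMatrix (Idx n) A = R, mMatrix n φ A = M at *
  -- With a, c the first legs and b, d the second legs of T, T', the order is reversed by five
  -- exchanges: a and d across M, c and d past R, R past M, a and b past R, and c and b across M.
  calc R * (c * a) * M * (d * b) = R * c * (a * M * d) * b := by noncomm_ring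
    _ = (R * c * d) * M * a * b := by rw [h3]; noncomm_ring
    _ = d * c * (R * M) * a * b := by rw [h2]; noncomm_ring
    _ = d * c * M * (R * a * b) := by rw [h5]; noncomm_ring
    _ = d * (c * M * b) * a * R := by rw [h1]; noncomm_ring
    _ = d * b * M * (c * a) * R := by rw [← h4]; noncomm_ring

end Mixed

theorem genMatrix_S {n : ℕ} (φ : ℤˣ) :
    genMatrix (S (n := n) φ) = genMatrix (tauT φ) * genMatrix T := by
  ext i j r
  rw [coeff_genMatrix, S, Sseries, Matrix.mul_apply]
  congr 2
  funext k
  congr 1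
  ext r
  rw [PowerSeries.coeff_map, Tseries, PowerSeries.coeff_mk, coeff_genMatrix]
  exact tau_T φ i k r

end TwistedYangian

namespace TwistedYangian

open Series₂ Matrix

/-! ### The symmetry relation -/

section Symmetry

variable {n : ℕ} {A : Type*} [Ring A] {t t' : Idx n → Idx n → ℕ → A}

-- In one copy of the sum the term with p.1 = 0 is dropped, in the other the term with p.2 = 0; both
-- are commutators with t^{(0)}. After shifting, the two copies pair up with opposite signs into the
-- left-hand side of the RTT relation.
open Finset.HasAntidiagonal in
theorem two_nsmul_sum_commutator (h : IsRTT t) (i j k l : Idx n) (m : ℕ) :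
    2 • ∑ p ∈ antidiagonal (m + 1), (-1 : ℤ) ^ p.2 •
        (t i j p.1 * t k l p.2 - t k l p.2 * t i j p.1)
      = ∑ p ∈ antidiagonal m, (-1 : ℤ) ^ p.2 • (t i l p.2 * t k j p.1 - t i l p.1 * t k j p.2) := by
  rw [two_nsmul]
  nth_rw 1 [Finset.Nat.sum_antidiagonal_succ]
  rw [Finset.Nat.sum_antidiagonal_succ']
  simp only [h.zero_commute, sub_self, smul_zero, zero_add]
  rw [← Finset.sum_add_distrib]
  refine Finset.sum_congr rfl fun p _ => ?_
  rw [← h.rel', pow_succ]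
  module

/-- The coefficients of the product of the matrices `t'` and `t`. -/
def prodCoeff (t' t : Idx n → Idx n → ℕ → A) (i j : Idx n) (m : ℕ) : A :=
  ∑ a, ∑ p ∈ Finset.HasAntidiagonal.antidiagonal m, t' i a p.1 * t a j p.2

theorem genMatrix_prodCoeff (t' t : Idx n → Idx n → ℕ → A) :
    genMatrix (prodCoeff t' t) = genMatrix t' * genMatrix t := by
  ext i j r
  simp [prodCoeff, Matrix.mul_apply, PowerSeries.coeff_mul]

theorem S_eq_prodCoeff (φ : ℤˣ) : S (n := n) φ = prodCoeff (tauT φ) T := by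
  funext i j r
  rw [← coeff_genMatrix (prodCoeff (tauT φ) T), genMatrix_prodCoeff, ← genMatrix_S,
    coeff_genMatrix]

theorem prodCoeff_eq {φ : ℤˣ} (ht' : IsTwistedTranspose φ t t') (i j : Idx n) (m : ℕ) :
    prodCoeff t' t i j m = ∑ a, (eps φ i * eps φ a) •
      ∑ p ∈ Finset.HasAntidiagonal.antidiagonal m, (-1 : ℤ) ^ p.2 •
        (t (-a) (-i) p.2 * t a j p.1) := by
  refine Finset.sum_congr rfl fun a _ => ?_
  rw [← Finset.Nat.sum_antidiagonal_swap, Finset.smul_sum]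
  refine Finset.sum_congr rfl fun p _ => ?_
  rw [ht'.eq, smul_smul, smul_mul_assoc]
  rfl

/-- The substitution a ↦ -a produces the sum of `prodCoeff_eq` with the two factors in opposite
order, so the difference of the two sides of the symmetry relation is a sum of commutators. -/
theorem prodCoeff_neg_eq {φ : ℤˣ} (hφ : Odd n → φ = 1) (ht' : IsTwistedTranspose φ t t')
    (i j : Idx n) (m : ℕ) :
    (eps φ i * eps φ j * (-1) ^ m) • prodCoeff t' t (-j) (-i) m = ∑ a, (eps φ i * eps φ a) •
      ∑ p ∈ Finset.HasAntidiagonal.antidiagonal m, (-1 : ℤ) ^ p.2 •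
        (t a j p.1 * t (-a) (-i) p.2) := by
  rw [prodCoeff, ← Equiv.sum_comp (Equiv.neg (Idx n)), Finset.smul_sum]
  refine Finset.sum_congr rfl fun a _ => ?_
  rw [Finset.smul_sum, Finset.smul_sum]
  refine Finset.sum_congr rfl fun p hp => ?_
  obtain rfl := Finset.HasAntidiagonal.mem_antidiagonal.1 hp
  rw [ht'.eq, smul_mul_assoc, smul_smul, smul_smul, Equiv.neg_apply, neg_neg, neg_neg,
    eps_neg hφ, eps_neg hφ]
  congr 1
  have h1 : ((-1 : ℤ) ^ p.1) * (-1) ^ p.1 = 1 := by rw [← mul_pow]; simp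
  rw [pow_add]
  linear_combination (eps φ i * eps φ a * (-1) ^ p.2) * (h1 * (eps φ j * eps φ j * φ * φ) +
    eps_mul_self φ j * φ * φ + units_mul_self φ)

/-- The symmetry relation. -/
theorem prodCoeff_symm {φ : ℤˣ} (hφ : Odd n → φ = 1) (h : IsRTT t)
    (ht' : IsTwistedTranspose φ t t') (i j : Idx n) (m : ℕ) :
    2 • ((eps φ i * eps φ j * (-1) ^ (m + 1)) • prodCoeff t' t (-j) (-i) (m + 1)
        - prodCoeff t' t i j (m + 1))
      = ((φ : ℤ) * (1 - (-1) ^ m)) • prodCoeff t' t i j m := by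
  rw [prodCoeff_neg_eq hφ ht', prodCoeff_eq ht', ← Finset.sum_sub_distrib]
  simp only [← smul_sub, ← Finset.sum_sub_distrib]
  rw [Finset.smul_sum]
  have e : ∀ a, 2 • ((eps φ i * eps φ a) •
      ∑ p ∈ Finset.HasAntidiagonal.antidiagonal (m + 1), (-1 : ℤ) ^ p.2 •
        (t a j p.1 * t (-a) (-i) p.2 - t (-a) (-i) p.2 * t a j p.1))
      = (eps φ i * eps φ a) •
      ∑ p ∈ Finset.HasAntidiagonal.antidiagonal m, (-1 : ℤ) ^ p.2 •
        (t a (-i) p.2 * t (-a) j p.1 - t a (-i) p.1 * t (-a) j p.2) := fun a => by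
    rw [← two_nsmul_sum_commutator h, smul_comm]
  rw [Finset.sum_congr rfl fun a _ => e a, prodCoeff_eq ht', Finset.smul_sum,
    ← Equiv.sum_comp (Equiv.neg (Idx n))]
  refine Finset.sum_congr rfl fun a _ => ?_
  simp only [smul_sub, Finset.sum_sub_distrib]
  -- Exchanging the two superscripts changes (-1)^{p.2} by (-1)^m; this is the origin of the factor
  -- 1 - (-1)^m.
  have e2 : ∑ p ∈ Finset.HasAntidiagonal.antidiagonal m, (-1 : ℤ) ^ p.2 •
      (t (-a) (-i) p.1 * t a j p.2) = (-1 : ℤ) ^ m •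
      ∑ p ∈ Finset.HasAntidiagonal.antidiagonal m, (-1 : ℤ) ^ p.2 •
        (t (-a) (-i) p.2 * t a j p.1) := by
    rw [← Finset.Nat.sum_antidiagonal_swap, Finset.smul_sum]
    refine Finset.sum_congr rfl fun p hp => ?_
    obtain rfl := Finset.HasAntidiagonal.mem_antidiagonal.1 hp
    have h1 : ((-1 : ℤ) ^ p.2) * (-1) ^ p.2 = 1 := by rw [← mul_pow]; simp
    rw [smul_smul, pow_add, mul_assoc, h1, mul_one]
    rfl
  rw [Equiv.neg_apply, neg_neg, e2, eps_neg hφ]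
  module

end Symmetry

/-! ### Filtrations by weight -/

section Filtration

variable {σ A : Type*} [Ring A] [Algebra ℂ A]

/-- The span of the products of the `f a` of total weight at most `d`. -/
def filt (f : σ → A) (w : σ → ℕ) (d : ℤ) : Submodule ℂ A :=
  Submodule.span ℂ {y | ∃ l : List σ, ((l.map w).sum : ℤ) ≤ d ∧ (l.map f).prod = y}

variable {f : σ → A} {w : σ → ℕ}

theorem prod_mem_filt {l : List σ} {d : ℤ} (h : ((l.map w).sum : ℤ) ≤ d) :
    (l.map f).prod ∈ filt f w d := Submodule.subset_span ⟨l, h, rfl⟩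

theorem mem_filt {a : σ} {d : ℤ} (h : (w a : ℤ) ≤ d) : f a ∈ filt f w d := by
  simpa using prod_mem_filt (f := f) (w := w) (l := [a]) (d := d) (by simpa using h)

theorem one_mem_filt : (1 : A) ∈ filt f w 0 := prod_mem_filt (l := []) (by simp)

theorem filt_mono {d e : ℤ} (h : d ≤ e) : filt f w d ≤ filt f w e := by
  refine Submodule.span_mono ?_
  rintro _ ⟨l, hl, rfl⟩
  exact ⟨l, hl.trans h, rfl⟩

theorem mul_mem_filt {d e : ℤ} {a b : A} (ha : a ∈ filt f w d) (hb : b ∈ filt f w e) :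
    a * b ∈ filt f w (d + e) := by
  have : filt f w d * filt f w e ≤ filt f w (d + e) := by
    rw [filt, filt, Submodule.span_mul_span, Submodule.span_le]
    rintro _ ⟨_, ⟨l, hl, rfl⟩, _, ⟨l', hl', rfl⟩, rfl⟩
    have := prod_mem_filt (f := f) (w := w) (l := l ++ l') (d := d + e) (by
      rw [List.map_append, List.sum_append, Nat.cast_add]; omega)
    rwa [List.map_append, List.prod_append] at this
  exact this (Submodule.mul_mem_mul ha hb)

theorem mul_mem_filt' {d e c : ℤ} {a b : A} (ha : a ∈ filt f w d) (hb : b ∈ filt f w e)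
    (h : d + e ≤ c) : a * b ∈ filt f w c := filt_mono h (mul_mem_filt ha hb)

/-- The two-variable series whose coefficients respect the filtration. -/
noncomputable def filtSubring (f : σ → A) (w : σ → ℕ) : Subring (Series₂ A) where
  carrier := {g | ∀ r s : ℕ, cf r s g ∈ filt f w (r + s)}
  mul_mem' {g h} hg hh r s := by
    rw [cf_mul]
    refine Submodule.sum_mem _ fun p hp => Submodule.sum_mem _ fun q hq => ?_
    have h1 := Finset.HasAntidiagonal.mem_antidiagonal.1 hp
    have h2 := Finset.HasAntidiagonal.mem_antidiagonal.1 hq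
    exact mul_mem_filt' (hg _ _) (hh _ _) (by omega)
  one_mem' r s := by
    have : (1 : Series₂ A) = inX 1 * inY 1 := by simp
    rw [this, cf_inX_mul_inY, PowerSeries.coeff_one, PowerSeries.coeff_one]
    split_ifs with h1 h2
    · subst h1 h2; simpa using one_mem_filt
    all_goals simp
  add_mem' hg hh r s := by rw [map_add]; exact Submodule.add_mem _ (hg r s) (hh r s)
  zero_mem' r s := by simp
  neg_mem' hg r s := by rw [map_neg]; exact Submodule.neg_mem _ (hg r s)

theorem mul_mem_matrix {κ B : Type*} [Fintype κ] [Ring B] (G : Subring B) {M N : Matrix κ κ B}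
    (hM : ∀ i j, M i j ∈ G) (hN : ∀ i j, N i j ∈ G) (i j : κ) : (M * N) i j ∈ G := by
  rw [Matrix.mul_apply]
  exact Subring.sum_mem _ fun k _ => G.mul_mem (hM i k) (hN k j)

/-- The coefficient of x^r y^{s+2} expresses c_{r,s} as c_{r-2,s+2} plus coefficients of g₁, g₂, g₃
of total degree at most r + s - 1. Induction on r in steps of two preserves the total degree and
ends at r = 0, where c vanishes, or at r = 1, where only g₁ contributes. -/
theorem commutator_mem_filt_of_series {f : σ → A} {w : σ → ℕ} {c g₁ g₂ g₃ : Series₂ A}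
    (h₁ : g₁ ∈ filtSubring f w) (h₂ : g₂ ∈ filtSubring f w) (h₃ : g₃ ∈ filtSubring f w)
    (h : y * (y * c) - x * (x * c) = x * (y * (y * g₁ + x * g₂ + x * (y * g₃))))
    (h0 : ∀ s, cf 0 s c = 0) (r s : ℕ) : cf r s c ∈ filt f w (r + s - 1) := by
  induction r using Nat.strong_induction_on generalizing s with
  | _ r ih =>
    have e := congrArg (cf r (s + 2)) h
    rcases r with _ | _ | r
    · rw [h0]; exact Submodule.zero_mem _
    · simp only [mul_add, map_add, map_sub, zero_add, cf_y_mul_succ, cf_x_mul_succ (r := 0),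
        cf_x_mul_zero, sub_zero, add_zero] at e
      rw [zero_add, e]
      exact filt_mono (by push_cast; omega) (h₁ 0 s)
    · rw [show s + 2 = (s + 1) + 1 from rfl] at e
      simp only [mul_add, map_add, map_sub, cf_y_mul_succ, cf_x_mul_succ] at e
      rw [sub_eq_iff_eq_add] at e
      rw [e]
      refine Submodule.add_mem _ (Submodule.add_mem _ (Submodule.add_mem _ ?_ ?_) ?_) ?_
      · exact filt_mono (by push_cast; omega) (h₁ (r + 1) s)
      · exact filt_mono (by push_cast; omega) (h₂ r (s + 1))
      · exact filt_mono (by push_cast; omega) (h₃ r s)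
      · exact filt_mono (by push_cast; omega) (ih r (by omega) (s + 1 + 1))

end Filtration

/-! ### Commutators drop the weight by one -/

section Commutator

variable {n : ℕ} {A : Type*} [Ring A] [Algebra ℂ A] {t t' : Idx n → Idx n → ℕ → A}

theorem reflection_expand_smul {K 𝕄 : Type*} [CommRing K] [Ring 𝕄] [Algebra K 𝕄] {u v : K}
    {P Q a b : 𝕄}
    (h : ((v - u) • 1 - (u * v) • P) * a * ((u + v) • 1 + (u * v) • Q) * b
      = b * ((u + v) • 1 + (u * v) • Q) * a * ((v - u) • 1 - (u * v) • P)) :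
    v • v • (a * b - b * a) - u • u • (a * b - b * a)
      = u • (v • (v • (P * a * b + b * Q * a - a * Q * b - b * a * P)
        + u • (a * Q * b + P * a * b - b * Q * a - b * a * P)
        + u • v • (P * a * Q * b - b * Q * a * P))) := by
  rw [← sub_eq_zero] at h ⊢
  rw [← h]
  simp only [mul_add, add_mul, mul_sub, sub_mul, mul_assoc, smul_mul_assoc, mul_smul_comm,
    one_mul, mul_one]
  module

/-- Central elements act as scalars over the centre, which reduces the claim to
`reflection_expand_smul`. -/
theorem reflection_expand {𝕄 : Type*} [Ring 𝕄] {u v P Q a b : 𝕄} (hu : ∀ m, Commute u m)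
    (hv : ∀ m, Commute v m)
    (h : ((v - u) - u * v * P) * a * ((u + v) + u * v * Q) * b
      = b * ((u + v) + u * v * Q) * a * ((v - u) - u * v * P)) :
    v * (v * (a * b - b * a)) - u * (u * (a * b - b * a))
      = u * (v * (v * (P * a * b + b * Q * a - a * Q * b - b * a * P)
        + u * (a * Q * b + P * a * b - b * Q * a - b * a * P)
        + u * (v * (P * a * Q * b - b * Q * a * P)))) := by
  have key := reflection_expand_smul (K := Subring.center 𝕄)
    (u := ⟨u, Subring.mem_center_iff.2 fun m => (hu m).eq.symm⟩)
    (v := ⟨v, Subring.mem_center_iff.2 fun m => (hv m).eq.symm⟩) (P := P) (Q := Q) (a := a) (b := b)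
  simp only [Subring.smul_def, smul_eq_mul, Subring.coe_add, AddSubgroupClass.coe_sub, Subring.coe_mul,
    mul_one] at key
  exact key h

/-- In the expanded reflection equation y² - x² multiplies the commutator, while every other term
has total degree at least 3 in the explicit variables. The gain of one degree becomes the loss of
one in weight. -/
theorem commutator_prodCoeff_mem {φ : ℤˣ} (hφ : Odd n → φ = 1) (h : IsRTT t)
    (ht' : IsTwistedTranspose φ t t') (i j k l : Idx n) (r s : ℕ) :
    prodCoeff t' t i j r * prodCoeff t' t k l s - prodCoeff t' t k l s * prodCoeff t' t i j r
      ∈ filt (fun a : Idx n × Idx n × ℕ => prodCoeff t' t a.1 a.2.1 a.2.2) (fun a => a.2.2)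
        (r + s - 1) := by
  set f := fun a : Idx n × Idx n × ℕ => prodCoeff t' t a.1 a.2.1 a.2.2 with hf
  set G := filtSubring f (fun a => a.2.2) with hG
  have h1 := reflection hφ h ht'
  rw [← genMatrix_prodCoeff] at h1
  set s₁ := leg₁ ((genMatrix (prodCoeff t' t)).map inX) with hs₁
  set s₂ := leg₂ ((genMatrix (prodCoeff t' t)).map inY) with hs₂
  have h2 := reflection_expand matX_commute matY_commute h1
  have m₁ : ∀ p q, s₁ p q ∈ G := by
    intro p q
    rw [hs₁, leg₁, Matrix.of_apply]
    split_ifs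
    · intro r s
      rw [Matrix.map_apply, ← mul_one (inX _), ← map_one inY, cf_inX_mul_inY, coeff_genMatrix,
        PowerSeries.coeff_one]
      split_ifs with h
      · subst h
        rw [mul_one]
        exact mem_filt (f := f) (a := (p.1, q.1, r)) (by simp)
      · simp
    · exact G.zero_mem
  have m₂ : ∀ p q, s₂ p q ∈ G := by
    intro p q
    rw [hs₂, leg₂, Matrix.of_apply]
    split_ifs
    · intro r s
      rw [Matrix.map_apply, ← one_mul (inY _), ← map_one inX, cf_inX_mul_inY, coeff_genMatrix,
        PowerSeries.coeff_one]
      split_ifs with h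
      · subst h
        rw [one_mul]
        exact mem_filt (f := f) (a := (p.2, q.2, s)) (by simp)
      · simp
    · exact G.zero_mem
  have mP : ∀ p q, swapMatrix (Idx n) (Series₂ A) p q ∈ G := by
    intro p q
    rw [swapMatrix, Matrix.of_apply]
    split_ifs
    exacts [G.one_mem, G.zero_mem]
  have mQ : ∀ p q, qMatrix n φ (Series₂ A) p q ∈ G := by
    have : ∀ p, qVec n φ (Series₂ A) p ∈ G := by
      intro p
      rw [qVec]
      split_ifs
      exacts [intCast_mem G _, G.zero_mem]
    intro p q
    exact G.mul_mem (this p) (this q)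
  have h3 := congrFun (congrFun h2 (i, k)) (j, l)
  simp only [Matrix.sub_apply, Matrix.add_apply, matX, matY, scalar_mul_apply'] at h3
  have h4 := commutator_mem_filt_of_series (f := f) (w := fun a => a.2.2) ?_ ?_ ?_ h3 ?_ r s
  · simpa [hs₁, hs₂, leg₁_mul_leg₂_apply, leg₂_mul_leg₁_apply] using h4
  · exact G.sub_mem (G.sub_mem (G.add_mem
      (mul_mem_matrix G (mul_mem_matrix G mP m₁) m₂ _ _)
      (mul_mem_matrix G (mul_mem_matrix G m₂ mQ) m₁ _ _))
      (mul_mem_matrix G (mul_mem_matrix G m₁ mQ) m₂ _ _))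
      (mul_mem_matrix G (mul_mem_matrix G m₂ m₁) mP _ _)
  · exact G.sub_mem (G.sub_mem (G.add_mem
      (mul_mem_matrix G (mul_mem_matrix G m₁ mQ) m₂ _ _)
      (mul_mem_matrix G (mul_mem_matrix G mP m₁) m₂ _ _))
      (mul_mem_matrix G (mul_mem_matrix G m₂ mQ) m₁ _ _))
      (mul_mem_matrix G (mul_mem_matrix G m₂ m₁) mP _ _)
  · exact G.sub_mem
      (mul_mem_matrix G (mul_mem_matrix G (mul_mem_matrix G mP m₁) mQ) m₂ _ _)
      (mul_mem_matrix G (mul_mem_matrix G (mul_mem_matrix G m₂ mQ) m₁) mP _ _)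
  · intro s
    have h0 : prodCoeff t' t i j 0 = if i = j then 1 else 0 := by
      simp [prodCoeff, h.zero, ht'.isRTT.zero]
    simp only [hs₁, hs₂, leg₁_mul_leg₂_apply, leg₂_mul_leg₁_apply, Matrix.map_apply, map_sub,
      cf_inX_mul_inY, cf_inY_mul_inX, coeff_genMatrix, h0]
    split_ifs <;> simp

end Commutator

end TwistedYangian

namespace TwistedYangian

set_option linter.unusedSectionVars false

/-! ### Sorting products modulo lower weight -/

section Ordered

variable {σ A : Type*} [Ring A] [LinearOrder σ]

/-- The word `a₁ … a₁ a₂ … a₂ …` in increasing order with multiplicities given by `m`. -/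
noncomputable def orderedWord (m : σ →₀ ℕ) : List σ :=
  (m.support.sort (· ≤ ·)).flatMap fun a => List.replicate (m a) a

theorem prod_map_orderedWord (f : σ → A) (m : σ →₀ ℕ) :
    ((orderedWord m).map f).prod = ((m.support.sort (· ≤ ·)).map fun a => f a ^ m a).prod := by
  unfold orderedWord
  induction m.support.sort (· ≤ ·) with
  | nil => simp
  | cons a l ih => simp [ih]

theorem coe_orderedWord (m : σ →₀ ℕ) :
    (orderedWord m : Multiset σ) = Finsupp.toMultiset m := by
  rw [orderedWord, ← Multiset.coe_bind, Finset.sort_eq, Finsupp.toMultiset_apply, Finsupp.sum,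
    Multiset.bind, Multiset.join, Finset.sum]
  simp only [Multiset.nsmul_singleton]
  rfl

theorem perm_orderedWord (l : List σ) : l.Perm (orderedWord (Multiset.toFinsupp (l : Multiset σ))) :=
  Multiset.coe_eq_coe.1 (by rw [coe_orderedWord, Multiset.toFinsupp_toMultiset])

variable [Algebra ℂ A] {f : σ → A} {w : σ → ℕ}

theorem prod_sub_prod_mem_filt_of_perm
    (hc : ∀ a b, f a * f b - f b * f a ∈ filt f w (w a + w b - 1)) {l l' : List σ}
    (h : l.Perm l') : (l.map f).prod - (l'.map f).prod ∈ filt f w ((l.map w).sum - 1) := by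
  induction h with
  | nil => simp
  | cons a h ih =>
    simp only [List.map_cons, List.prod_cons, ← mul_sub]
    refine mul_mem_filt' (mem_filt (w := w) le_rfl) ih ?_
    rw [List.sum_cons]; push_cast; omega
  | swap a b l =>
    simp only [List.map_cons, List.prod_cons, ← mul_assoc, ← sub_mul]
    refine mul_mem_filt' (hc b a) (prod_mem_filt le_rfl) ?_
    simp only [List.sum_cons]; push_cast; omega
  | trans h₁ h₂ ih₁ ih₂ =>
    rw [← (h₁.map w).sum_eq] at ih₂
    simpa using Submodule.add_mem _ ih₁ ih₂

/-- If commutators have lower degree, then the ordered monomials span. -/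
theorem filt_le_span_ordered (hc : ∀ a b, f a * f b - f b * f a ∈ filt f w (w a + w b - 1))
    (N : ℕ) : filt f w (N - 1) ≤ Submodule.span ℂ
      (Set.range fun m : σ →₀ ℕ => ((m.support.sort (· ≤ ·)).map fun a => f a ^ m a).prod) := by
  induction N with
  | zero =>
    -- The bound is -1 and words have nonnegative weight, so the spanning set is empty.
    refine Submodule.span_le.2 ?_
    rintro _ ⟨l, hl, rfl⟩
    omega
  | succ N ih =>
    refine Submodule.span_le.2 ?_
    rintro _ ⟨l, hl, rfl⟩
    have h := prod_sub_prod_mem_filt_of_perm hc (perm_orderedWord l)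
    have h' := ih (filt_mono (by push_cast at hl ⊢; omega) h)
    rw [← sub_add_cancel (l.map f).prod
      ((orderedWord (Multiset.toFinsupp (l : Multiset σ))).map f).prod]
    refine Submodule.add_mem _ h' (Submodule.subset_span ?_)
    exact ⟨_, (prod_map_orderedWord f _).symm⟩

end Ordered

/-! ### Reduction to admissible generators -/

section Admissible

variable {n : ℕ} {A : Type*} [Ring A] [Algebra ℂ A] {t t' : Idx n → Idx n → ℕ → A}

/-- The admissible generators. -/
def admGen (φ : ℤˣ) (t' t : Idx n → Idx n → ℕ → A) (a : AdmissibleTriple n φ) : A :=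
  prodCoeff t' t a.i a.j a.r

theorem prodCoeff_symm_smul {φ : ℤˣ} (hφ : Odd n → φ = 1) (h : IsRTT t)
    (ht' : IsTwistedTranspose φ t t') (i j : Idx n) (m : ℕ) :
    ∃ c : ℂ, prodCoeff t' t i j (m + 1)
      = ((eps φ i * eps φ j * (-1) ^ (m + 1) : ℤ) : ℂ) • prodCoeff t' t (-j) (-i) (m + 1)
        + c • prodCoeff t' t i j m := by
  have e := prodCoeff_symm hφ h ht' i j m
  rw [← Int.cast_smul_eq_zsmul ℂ, ← Int.cast_smul_eq_zsmul ℂ, ← Nat.cast_smul_eq_nsmul ℂ] at e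
  refine ⟨-(1 / 2 * (((φ : ℤ) * (1 - (-1) ^ m) : ℤ) : ℂ)), ?_⟩
  rw [neg_smul, mul_smul, ← e]
  module

theorem prodCoeff_zero (h : IsRTT t) (h' : IsRTT t') (i j : Idx n) :
    prodCoeff t' t i j 0 = if i = j then 1 else 0 := by
  simp [prodCoeff, h.zero, h'.zero]

/-- If i + j < 0 the triple is admissible; if i + j > 0 the symmetry relation passes to (-j, -i),
whose sum is negative, at the cost of a term with smaller r. On i + j = 0 the relation links the
element to itself with sign φ(-1)^r. -/
theorem prodCoeff_mem_filt_admGen {φ : ℤˣ} (hφ : Odd n → φ = 1) (h : IsRTT t)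
    (ht' : IsTwistedTranspose φ t t') (r : ℕ) (i j : Idx n) :
    prodCoeff t' t i j r ∈ filt (admGen φ t' t) AdmissibleTriple.r r := by
  induction r with
  | zero =>
    rw [prodCoeff_zero h ht'.isRTT]
    split_ifs
    exacts [one_mem_filt, Submodule.zero_mem _]
  | succ m ih =>
    obtain ⟨c, hc⟩ := prodCoeff_symm_smul hφ h ht' i j m
    have ih' : c • prodCoeff t' t i j m ∈ filt (admGen φ t' t) AdmissibleTriple.r ↑(m + 1) :=
      Submodule.smul_mem _ _ (filt_mono (by push_cast; omega) ih)
    rcases lt_trichotomy (i.1 + j.1) 0 with hlt | heq | hgt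
    · exact mem_filt (f := admGen φ t' t) (a := ⟨i, j, m + 1, by omega, by omega, by omega,
        by omega, by omega⟩) le_rfl
    · obtain rfl : j = -i := Subtype.ext (by rw [neg_val]; omega)
      rw [neg_neg, eps_neg hφ] at hc
      have hs : eps φ i * (φ * eps φ i) * (-1) ^ (m + 1) = (φ : ℤ) * (-1) ^ (m + 1) := by
        linear_combination (φ * (-1) ^ (m + 1)) * eps_mul_self φ i
      rw [hs] at hc
      -- Sign +1 is exactly admissibility on i + j = 0. Sign -1 makes twice the element a multiple
      -- of the previous coefficient.
      by_cases hp : (φ : ℤ) * (-1) ^ (m + 1) = 1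
      · have hev : φ = 1 → ¬ Odd (m + 1) := by
          rintro rfl ho
          rw [ho.neg_one_pow] at hp
          norm_num at hp
        have hod : φ = -1 → ¬ Even (m + 1) := by
          rintro rfl ho
          rw [ho.neg_one_pow] at hp
          norm_num at hp
        exact mem_filt (f := admGen φ t' t) (a := ⟨i, -i, m + 1, by omega, fun _ _ => heq.le,
          fun h1 h2 => absurd h2 (hev h1), fun h1 h2 => absurd h2 (hod h1),
          fun _ _ => heq.le⟩) le_rfl
      · have hp' : (φ : ℤ) * (-1) ^ (m + 1) = -1 := by
          rcases Int.units_eq_one_or φ with rfl | rfl <;>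
            rcases neg_one_pow_eq_or ℤ (m + 1) with h1 | h1 <;> simp_all
        rw [hp'] at hc
        have : prodCoeff t' t i (-i) (m + 1) = (1 / 2 : ℂ) • c • prodCoeff t' t i (-i) m := by
          rw [← sub_eq_iff_eq_add'] at hc
          rw [← hc]
          push_cast
          module
        rw [this]
        exact Submodule.smul_mem _ _ ih'
    · rw [hc]
      refine Submodule.add_mem _ (Submodule.smul_mem _ _ ?_) ih'
      have : (-j).1 + (-i).1 < 0 := by rw [neg_val, neg_val]; omega
      exact mem_filt (f := admGen φ t' t) (a := ⟨-j, -i, m + 1, by omega, by omega, by omega,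
        by omega, by omega⟩) le_rfl

theorem filt_le_filt {σ τ : Type*} {f : σ → A} {w : σ → ℕ} {g : τ → A} {v : τ → ℕ}
    (h : ∀ a, f a ∈ filt g v (w a)) (d : ℤ) : filt f w d ≤ filt g v d := by
  refine Submodule.span_le.2 ?_
  rintro _ ⟨l, hl, rfl⟩
  refine filt_mono hl ?_
  clear hl
  induction l with
  | nil => simpa using one_mem_filt
  | cons a l ih =>
    rw [List.map_cons, List.map_cons, List.prod_cons, List.sum_cons, Nat.cast_add]
    exact mul_mem_filt (h a) ih

theorem commutator_admGen_mem {φ : ℤˣ} (hφ : Odd n → φ = 1) (h : IsRTT t)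
    (ht' : IsTwistedTranspose φ t t') (a b : AdmissibleTriple n φ) :
    admGen φ t' t a * admGen φ t' t b - admGen φ t' t b * admGen φ t' t a
      ∈ filt (admGen φ t' t) AdmissibleTriple.r (a.r + b.r - 1) :=
  have h1 : ∀ c : Idx n × Idx n × ℕ, (fun c : Idx n × Idx n × ℕ => prodCoeff t' t c.1 c.2.1 c.2.2) c
      ∈ filt (admGen φ t' t) AdmissibleTriple.r ((fun c : Idx n × Idx n × ℕ => c.2.2) c) :=
    fun c => prodCoeff_mem_filt_admGen hφ h ht' c.2.2 c.1 c.2.1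
  filt_le_filt h1 _ (commutator_prodCoeff_mem hφ h ht' a.i a.j b.i b.j a.r b.r)

theorem adjoin_le_span {φ : ℤˣ} (hφ : Odd n → φ = 1) (h : IsRTT t)
    (ht' : IsTwistedTranspose φ t t') [LinearOrder (AdmissibleTriple n φ)] {x : A}
    (hx : x ∈ Algebra.adjoin ℂ {x | ∃ (i j : Idx n) (r : ℕ), 1 ≤ r ∧ x = prodCoeff t' t i j r}) :
    x ∈ Submodule.span ℂ (Set.range fun m : AdmissibleTriple n φ →₀ ℕ =>
      ((m.support.sort (· ≤ ·)).map fun a => admGen φ t' t a ^ m a).prod) := by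
  -- The filtration is exhaustive on the subalgebra, so a bound depending on x is enough.
  suffices ∃ N : ℕ, x ∈ filt (admGen φ t' t) AdmissibleTriple.r N by
    obtain ⟨N, hN⟩ := this
    exact filt_le_span_ordered (commutator_admGen_mem hφ h ht') (N + 1)
      (filt_mono (by push_cast; omega) hN)
  induction hx using Algebra.adjoin_induction with
  | mem x hx =>
    obtain ⟨i, j, r, -, rfl⟩ := hx
    exact ⟨r, prodCoeff_mem_filt_admGen hφ h ht' r i j⟩
  | algebraMap c =>
    refine ⟨0, ?_⟩
    rw [Algebra.algebraMap_eq_smul_one]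
    exact Submodule.smul_mem _ _ one_mem_filt
  | add x y _ _ hx hy =>
    obtain ⟨N, hN⟩ := hx
    obtain ⟨N', hN'⟩ := hy
    exact ⟨N + N', Submodule.add_mem _ (filt_mono (by push_cast; omega) hN)
      (filt_mono (by push_cast; omega) hN')⟩
  | mul x y _ _ hx hy =>
    obtain ⟨N, hN⟩ := hx
    obtain ⟨N', hN'⟩ := hy
    exact ⟨N + N', mul_mem_filt' hN hN' (by push_cast; omega)⟩

end Admissible

section Span

variable {n : ℕ} {φ : ℤˣ}

theorem orderedMonomial_eq [LinearOrder (AdmissibleTriple n φ)] (m : AdmissibleTriple n φ →₀ ℕ) :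
    orderedMonomial m = ((m.support.sort (· ≤ ·)).map fun a =>
      admGen φ (tauT φ) T a ^ m a).prod := by
  simp only [admGen, ← S_eq_prodCoeff]
  rfl

theorem mem_span_of_mem_twistedYangian (hφ : Odd n → φ = 1)
    [LinearOrder (AdmissibleTriple n φ)] {x : Yangian n} (hx : x ∈ twistedYangian n φ) :
    x ∈ Submodule.span ℂ (Set.range (orderedMonomial (n := n) (φ := φ))) := by
  rw [twistedYangian, S_eq_prodCoeff] at hx
  have e : orderedMonomial (n := n) (φ := φ) = _ := funext orderedMonomial_eq
  rw [e]
  exact adjoin_le_span hφ (isRTT_T n) (isTwistedTranspose_tauT φ) hx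

theorem orderedMonomial_mem [LinearOrder (AdmissibleTriple n φ)]
    (m : AdmissibleTriple n φ →₀ ℕ) : orderedMonomial m ∈ twistedYangian n φ := by
  refine Subalgebra.list_prod_mem _ fun x hx => ?_
  obtain ⟨a, -, rfl⟩ := List.mem_map.1 hx
  have ha : S φ a.i a.j a.r ∈ twistedYangian n φ :=
    Algebra.subset_adjoin ⟨a.i, a.j, a.r, a.one_le, rfl⟩
  exact Subalgebra.pow_mem _ ha _

end Span

end TwistedYangian

namespace TwistedYangian

open scoped TensorProduct

/-! ### Convolution powers on products of primitive elements -/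

section Splits

variable {α : Type*}

/-- All ways to distribute the letters of a word over two words. -/
def splits : List α → List (List α × List α)
  | [] => [([], [])]
  | a :: l => (splits l).map (fun s => (a :: s.1, s.2)) ++ (splits l).map (fun s => (s.1, a :: s.2))

theorem perm_of_mem_splits {l : List α} {s : List α × List α} (h : s ∈ splits l) :
    (s.1 ++ s.2).Perm l := by
  induction l generalizing s with
  | nil =>
    rw [splits, List.mem_singleton] at h
    subst h
    rfl
  | cons a l ih =>
    rw [splits, List.mem_append, List.mem_map, List.mem_map] at h
    rcases h with ⟨s, hs, rfl⟩ | ⟨s, hs, rfl⟩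
    · exact (ih hs).cons a
    · exact List.perm_middle.trans ((ih hs).cons a)

theorem sum_splits_nil {M : Type*} [AddCommMonoid M] (l : List α) (c : M) :
    ((splits l).map fun s => if s.2.length = 0 then c else 0).sum = c := by
  induction l with
  | nil => simp [splits]
  | cons a l ih =>
    simp only [splits, List.map_append, List.map_map, Function.comp_def, List.sum_append, ih,
      List.length_cons]
    simp

/-- A single letter can be split off in as many ways as the word has letters; these counts multiply
up to the factorial in `coeff_convPow`. -/
theorem sum_splits_singleton {M : Type*} [AddCommMonoid M] (l : List α) (c : M) :
    ((splits l).map fun s => if s.2.length = 1 then c else 0).sum = l.length • c := by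
  induction l with
  | nil => simp [splits]
  | cons a l ih =>
    simp only [splits, List.map_append, List.map_map, Function.comp_def, List.sum_append, ih,
      List.length_cons, Nat.add_eq_right, sum_splits_nil]
    rw [succ_nsmul]

end Splits

section Tensor

variable {σ Y : Type*} [Ring Y] [Algebra ℂ Y] {g : σ → Y} {w : σ → ℕ}

/-- The filtration of the tensor square by total degree. -/
def filt₂ (g : σ → Y) (w : σ → ℕ) (D : ℤ) : Submodule ℂ (Y ⊗[ℂ] Y) :=
  Submodule.span ℂ {z | ∃ d e : ℤ, ∃ a b, a ∈ filt g w d ∧ b ∈ filt g w e ∧ d + e ≤ D ∧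
    a ⊗ₜ[ℂ] b = z}

theorem tmul_mem_filt₂ {d e D : ℤ} {a b : Y} (ha : a ∈ filt g w d) (hb : b ∈ filt g w e)
    (h : d + e ≤ D) : a ⊗ₜ[ℂ] b ∈ filt₂ g w D :=
  Submodule.subset_span ⟨d, e, a, b, ha, hb, h, rfl⟩

theorem filt₂_mono {D E : ℤ} (h : D ≤ E) : filt₂ g w D ≤ filt₂ g w E := by
  refine Submodule.span_le.2 ?_
  rintro _ ⟨d, e, a, b, ha, hb, h', rfl⟩
  exact tmul_mem_filt₂ ha hb (h'.trans h)

theorem mul_mem_filt₂ {D E F : ℤ} {a b : Y ⊗[ℂ] Y} (ha : a ∈ filt₂ g w D)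
    (hb : b ∈ filt₂ g w E) (h : D + E ≤ F) : a * b ∈ filt₂ g w F := by
  have : filt₂ g w D * filt₂ g w E ≤ filt₂ g w F := by
    rw [filt₂, filt₂, Submodule.span_mul_span, Submodule.span_le]
    rintro _ ⟨_, ⟨d, e, a, b, ha, hb, h1, rfl⟩, _, ⟨d', e', a', b', ha', hb', h2, rfl⟩, rfl⟩
    change a ⊗ₜ[ℂ] b * a' ⊗ₜ[ℂ] b' ∈ _
    rw [Algebra.TensorProduct.tmul_mul_tmul]
    exact tmul_mem_filt₂ (mul_mem_filt ha ha') (mul_mem_filt hb hb') (by omega)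
  exact this (Submodule.mul_mem_mul ha hb)

theorem one_mem_filt₂ : (1 : Y ⊗[ℂ] Y) ∈ filt₂ g w 0 :=
  tmul_mem_filt₂ one_mem_filt one_mem_filt le_rfl

theorem prod_tmul_add_tmul {β : Type*} (y : β → Y) (l : List β) :
    (l.map fun b => y b ⊗ₜ[ℂ] (1 : Y) + (1 : Y) ⊗ₜ[ℂ] y b).prod
      = ((splits l).map fun s => (s.1.map y).prod ⊗ₜ[ℂ] (s.2.map y).prod).sum := by
  induction l with
  | nil => simp [splits, Algebra.TensorProduct.one_def]
  | cons a l ih =>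
    rw [List.map_cons, List.prod_cons, ih, ← List.sum_map_mul_left, splits, List.map_append,
      List.sum_append]
    simp only [List.map_map, Function.comp_def, add_mul, Algebra.TensorProduct.tmul_mul_tmul,
      one_mul, List.map_cons, List.prod_cons, List.sum_map_add]

end Tensor

section Convolution

variable {σ Y P : Type*} [Ring Y] [Algebra ℂ Y] [CommRing P] [Algebra ℂ P] {g : σ → Y}
  {w : σ → ℕ}

/-- Polynomials of degree at most `d`. -/
def degLE (P : Type*) [CommRing P] [Algebra ℂ P] (d : ℤ) : Submodule ℂ (Polynomial P) where
  carrier := {p | ∀ e : ℕ, d < e → p.coeff e = 0}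
  add_mem' hp hq e he := by rw [Polynomial.coeff_add, hp e he, hq e he, add_zero]
  zero_mem' e _ := Polynomial.coeff_zero e
  smul_mem' c p hp e he := by rw [Polynomial.coeff_smul, hp e he, smul_zero]

theorem mul_mem_degLE {d e D : ℤ} {p q : Polynomial P} (hp : p ∈ degLE P d) (hq : q ∈ degLE P e)
    (h : d + e ≤ D) : p * q ∈ degLE P D := by
  intro k hk
  rw [Polynomial.coeff_mul]
  refine Finset.sum_eq_zero fun x hx => ?_
  have hx := Finset.HasAntidiagonal.mem_antidiagonal.1 hx
  by_cases h1 : d < x.1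
  · rw [hp _ h1, zero_mul]
  · rw [hq _ (by omega), mul_zero]

theorem coeff_mul_of_mem_degLE {d e : ℕ} {p q : Polynomial P} (hp : p ∈ degLE P d)
    (hq : q ∈ degLE P e) : (p * q).coeff (d + e) = p.coeff d * q.coeff e :=
  Polynomial.coeff_mul_add_eq_of_natDegree_le
    (Polynomial.natDegree_le_iff_coeff_eq_zero.2 fun k hk => hp k (by exact_mod_cast hk))
    (Polynomial.natDegree_le_iff_coeff_eq_zero.2 fun k hk => hq k (by exact_mod_cast hk))

/-- Elements that are primitive of weight `d` up to terms of lower weight, with symbol `f`. -/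
structure IsPrim (g : σ → Y) (w : σ → ℕ) (Δ : Y →ₐ[ℂ] Y ⊗[ℂ] Y) (ξ : Y →ₗ[ℂ] Polynomial P)
    (d : ℕ) (f : P) (y : Y) : Prop where
  mem : y ∈ filt g w d
  comul : Δ y - (y ⊗ₜ 1 + 1 ⊗ₜ y) ∈ filt₂ g w (d - 1)
  symbol : (ξ y).coeff d = f

/-- The convolution of two linear maps. -/
noncomputable def convolution (Δ : Y →ₐ[ℂ] Y ⊗[ℂ] Y) (Λ ξ : Y →ₗ[ℂ] Polynomial P) :
    Y →ₗ[ℂ] Polynomial P :=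
  LinearMap.mul' ℂ (Polynomial P) ∘ₗ TensorProduct.map Λ ξ ∘ₗ Δ.toLinearMap

/-- Convolution powers. -/
noncomputable def convPow (Δ : Y →ₐ[ℂ] Y ⊗[ℂ] Y) (ε ξ : Y →ₗ[ℂ] Polynomial P) :
    ℕ → Y →ₗ[ℂ] Polynomial P
  | 0 => ε
  | p + 1 => convolution Δ (convPow Δ ε ξ p) ξ

variable {Δ : Y →ₐ[ℂ] Y ⊗[ℂ] Y} {ε ξ Λ : Y →ₗ[ℂ] Polynomial P}

theorem mul'_map_mem_degLE (hΛ : ∀ d, ∀ y ∈ filt g w d, Λ y ∈ degLE P d)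
    (hξ : ∀ d, ∀ y ∈ filt g w d, ξ y ∈ degLE P d) {D : ℤ} {z : Y ⊗[ℂ] Y} (hz : z ∈ filt₂ g w D) :
    LinearMap.mul' ℂ (Polynomial P) (TensorProduct.map Λ ξ z) ∈ degLE P D := by
  induction hz using Submodule.span_induction with
  | mem z h =>
    obtain ⟨d, e, a, b, ha, hb, h, rfl⟩ := h
    rw [TensorProduct.map_tmul, LinearMap.mul'_apply]
    exact mul_mem_degLE (hΛ d a ha) (hξ e b hb) h
  | zero => simp
  | add a b _ _ ha hb => rw [map_add, map_add]; exact Submodule.add_mem _ ha hb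
  | smul c a _ ha => rw [map_smul, map_smul]; exact Submodule.smul_mem _ _ ha

theorem comul_mem_filt₂ (hΔ : ∀ a, Δ (g a) ∈ filt₂ g w (w a)) {d : ℤ} {y : Y}
    (hy : y ∈ filt g w d) : Δ y ∈ filt₂ g w d := by
  induction hy using Submodule.span_induction with
  | mem y h =>
    obtain ⟨l, hl, rfl⟩ := h
    refine filt₂_mono hl ?_
    clear hl
    induction l with
    | nil => simpa using one_mem_filt₂
    | cons a l ih =>
      simp only [List.map_cons, List.prod_cons, map_mul, List.sum_cons]
      exact mul_mem_filt₂ (hΔ a) ih (by push_cast; rfl)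
  | zero => simp
  | add a b _ _ ha hb => rw [map_add]; exact Submodule.add_mem _ ha hb
  | smul c a _ ha => rw [map_smul]; exact Submodule.smul_mem _ _ ha

theorem convPow_mem_degLE (hΔ : ∀ a, Δ (g a) ∈ filt₂ g w (w a))
    (hε : ∀ d, ∀ y ∈ filt g w d, ε y ∈ degLE P d) (hξ : ∀ d, ∀ y ∈ filt g w d, ξ y ∈ degLE P d)
    (p : ℕ) : ∀ d, ∀ y ∈ filt g w d, convPow Δ ε ξ p y ∈ degLE P d := by
  induction p with
  | zero => exact hε
  | succ p ih =>
    intro d y hy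
    exact mul'_map_mem_degLE ih hξ (comul_mem_filt₂ hΔ hy)

variable {β : Type*} {y : β → Y} {d : β → ℕ} {f : β → P}

theorem IsPrim.prod_mem (h : ∀ b, IsPrim g w Δ ξ (d b) (f b) (y b)) (l : List β) :
    (l.map y).prod ∈ filt g w ((l.map d).sum : ℕ) := by
  induction l with
  | nil => simpa using one_mem_filt
  | cons a l ih =>
    simp only [List.map_cons, List.prod_cons, List.sum_cons, Nat.cast_add]
    exact mul_mem_filt (h a).mem ih

/-- The factors Δ(y) are replaced by y ⊗ 1 + 1 ⊗ y one at a time; each replacement costs a term of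
weight lower by one. -/
theorem IsPrim.comul_prod (hΔ : ∀ a, Δ (g a) ∈ filt₂ g w (w a))
    (h : ∀ b, IsPrim g w Δ ξ (d b) (f b) (y b)) (l : List β) :
    Δ (l.map y).prod - (l.map fun b => y b ⊗ₜ[ℂ] (1 : Y) + (1 : Y) ⊗ₜ[ℂ] y b).prod
      ∈ filt₂ g w ((l.map d).sum - 1) := by
  induction l with
  | nil => simp
  | cons a l ih =>
    simp only [List.map_cons, List.prod_cons, List.sum_cons, map_mul]
    rw [← sub_add_sub_cancel _ ((y a ⊗ₜ[ℂ] (1 : Y) + (1 : Y) ⊗ₜ[ℂ] y a) * Δ (l.map y).prod),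
      ← sub_mul, ← mul_sub]
    refine Submodule.add_mem _
      (mul_mem_filt₂ (h a).comul (comul_mem_filt₂ hΔ (IsPrim.prod_mem h l))
        (by push_cast; omega))
      (mul_mem_filt₂ (D := d a) ?_ ih (by push_cast; omega))
    exact Submodule.add_mem _ (tmul_mem_filt₂ (h a).mem one_mem_filt (by omega))
      (tmul_mem_filt₂ one_mem_filt (h a).mem (by omega))

/-- The top symbols of the convolution powers on products of primitive elements. -/
theorem coeff_convPow (hΔ : ∀ a, Δ (g a) ∈ filt₂ g w (w a))
    (hε : ∀ d, ∀ y ∈ filt g w d, ε y ∈ degLE P d) (hξ : ∀ d, ∀ y ∈ filt g w d, ξ y ∈ degLE P d)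
    (hε1 : ε 1 = 1) (hξ1 : ξ 1 = 0)
    (h : ∀ b, IsPrim g w Δ ξ (d b) (f b) (y b)) (p : ℕ) (l : List β) (hl : l.length ≤ p) :
    (convPow Δ ε ξ p (l.map y).prod).coeff (l.map d).sum
      = if l.length = p then p.factorial • (l.map f).prod else 0 := by
  induction p generalizing l with
  | zero =>
    obtain rfl : l = [] := by simpa using hl
    simp [convPow, hε1]
  | succ p ih =>
    have hΛ := convPow_mem_degLE hΔ hε hξ p
    -- The error made by treating all factors as exactly primitive has lower weight and does not
    -- reach the coefficient under consideration.
    have e1 := mul'_map_mem_degLE hΛ hξ (IsPrim.comul_prod hΔ h l) (l.map d).sum (by omega)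
    rw [map_sub, map_sub, Polynomial.coeff_sub, sub_eq_zero] at e1
    change (LinearMap.mul' ℂ (Polynomial P) (TensorProduct.map (convPow Δ ε ξ p) ξ
      (Δ (l.map y).prod))).coeff _ = _
    rw [e1, prod_tmul_add_tmul, map_list_sum, map_list_sum, List.map_map, List.map_map]
    -- Only splittings whose second word is one letter survive: an empty second word is killed by ξ
    -- 1 = 0, and a longer one leaves a first word of length below p, which the induction hypothesis
    -- sends to 0.
    have e2 : ∀ s ∈ splits l, (convPow Δ ε ξ p (s.1.map y).prod * ξ (s.2.map y).prod).coeff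
        (l.map d).sum = if l.length = p + 1 then
          (if s.2.length = 1 then p.factorial • (l.map f).prod else 0) else 0 := by
      intro s hs
      have hp := perm_of_mem_splits hs
      have hlen := hp.length_eq
      rw [List.length_append] at hlen
      rw [← (hp.map d).sum_eq, ← (hp.map f).prod_eq, List.map_append, List.sum_append,
        List.map_append, List.prod_append,
        coeff_mul_of_mem_degLE (hΛ _ _ (IsPrim.prod_mem h s.1)) (hξ _ _ (IsPrim.prod_mem h s.2))]
      rcases hs2 : s.2 with _ | ⟨b, _ | ⟨b', l'⟩⟩
      · simp [hξ1]
      · rw [hs2, List.length_singleton] at hlen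
        rw [ih s.1 (by omega)]
        by_cases hq : l.length = p + 1
        · rw [if_pos hq, if_pos (by omega)]
          simp [(h b).symbol, mul_assoc]
        · rw [if_neg hq, if_neg (by omega), zero_mul]
      · rw [hs2, List.length_cons, List.length_cons] at hlen
        rw [ih s.1 (by omega), if_neg (by omega)]
        simp
    have e3 : ((splits l).map ((LinearMap.mul' ℂ (Polynomial P) ∘
        (TensorProduct.map (convPow Δ ε ξ p) ξ)) ∘
          fun s => (s.1.map y).prod ⊗ₜ[ℂ] (s.2.map y).prod)).sum.coeff (l.map d).sum
        = ((splits l).map fun s => (convPow Δ ε ξ p (s.1.map y).prod *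
          ξ (s.2.map y).prod).coeff (l.map d).sum).sum := by
      rw [← Polynomial.lcoeff_apply, map_list_sum, List.map_map]
      rfl
    rw [e3, List.map_congr_left e2]
    split_ifs with hq
    · rw [sum_splits_singleton, hq, smul_smul, Nat.factorial_succ]
    · simp

end Convolution

/-! ### Separation of ordered monomials -/

section Independence

variable {σ τ Y : Type*} [Ring Y] [Algebra ℂ Y] {g : σ → Y} {w : σ → ℕ} [LinearOrder τ]
  {Δ : Y →ₐ[ℂ] Y ⊗[ℂ] Y} {ε ξ : Y →ₗ[ℂ] Polynomial (MvPolynomial τ ℂ)} {y : τ → Y} {d : τ → ℕ}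

theorem prod_X_orderedWord (m : τ →₀ ℕ) :
    ((orderedWord m).map (MvPolynomial.X (R := ℂ))).prod = MvPolynomial.monomial m 1 := by
  rw [← Multiset.prod_coe, ← Multiset.map_coe, coe_orderedWord, MvPolynomial.monomial_eq,
    Finsupp.toMultiset_map, Finsupp.prod_toMultiset, Finsupp.prod_mapDomain_index]
  · simp
  · simp
  · simp [pow_add]

/-- In a vanishing combination choose a monomial maximal first in weight D, then in length p. In
degree D the p-th convolution power kills monomials of smaller weight or length, and sends the
others to p! times distinct monomials in the variables. -/
theorem linearIndependent_of_isPrim (hΔ : ∀ a, Δ (g a) ∈ filt₂ g w (w a))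
    (hε : ∀ d, ∀ y ∈ filt g w d, ε y ∈ degLE _ d) (hξ : ∀ d, ∀ y ∈ filt g w d, ξ y ∈ degLE _ d)
    (hε1 : ε 1 = 1) (hξ1 : ξ 1 = 0)
    (h : ∀ b, IsPrim g w Δ ξ (d b) (MvPolynomial.X b) (y b)) :
    LinearIndependent ℂ fun m : τ →₀ ℕ =>
      ((m.support.sort (· ≤ ·)).map fun a => y a ^ m a).prod := by
  simp only [← prod_map_orderedWord]
  rw [linearIndependent_iff]
  intro c hc
  by_contra hne
  obtain ⟨m₀, hm₀, hmax⟩ := c.support.exists_max_image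
    (fun m => toLex (((orderedWord m).map d).sum, (orderedWord m).length))
    (Finsupp.support_nonempty_iff.2 hne)
  set D := ((orderedWord m₀).map d).sum
  set p := (orderedWord m₀).length
  have key : ∀ m ∈ c.support, m ≠ m₀ → MvPolynomial.coeff m₀
      ((convPow Δ ε ξ p ((orderedWord m).map y).prod).coeff D) = 0 := by
    intro m hm hmm
    have h1 := Prod.Lex.le_iff.1 (hmax m hm)
    simp only [ofLex_toLex] at h1
    rcases h1 with h1 | ⟨h1, h2⟩
    · rw [convPow_mem_degLE hΔ hε hξ p _ _ (IsPrim.prod_mem h (orderedWord m)) D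
        (by exact_mod_cast h1), MvPolynomial.coeff_zero]
    · rw [← h1, coeff_convPow hΔ hε hξ hε1 hξ1 h p _ h2, prod_X_orderedWord]
      split_ifs
      · rw [MvPolynomial.coeff_smul, MvPolynomial.coeff_monomial, if_neg hmm, smul_zero]
      · simp
  have h0 := congrArg (fun z => MvPolynomial.coeff m₀ ((convPow Δ ε ξ p z).coeff D)) hc
  simp only [Finsupp.linearCombination_apply, Finsupp.sum, map_sum, map_smul,
    Polynomial.finsetSum_coeff, Polynomial.coeff_smul, MvPolynomial.coeff_sum,
    MvPolynomial.coeff_smul, map_zero, Polynomial.coeff_zero, MvPolynomial.coeff_zero] at h0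
  rw [Finset.sum_eq_single_of_mem m₀ hm₀ fun m hm hmm => by rw [key m hm hmm, smul_zero],
    coeff_convPow hΔ hε hξ hε1 hξ1 h p _ le_rfl, if_pos rfl, prod_X_orderedWord,
    MvPolynomial.coeff_smul, MvPolynomial.coeff_monomial, if_pos rfl] at h0
  have : c m₀ ≠ 0 := Finsupp.mem_support_iff.1 hm₀
  simp [this, Nat.factorial_ne_zero] at h0

end Independence

end TwistedYangian

namespace TwistedYangian

open scoped TensorProduct

/-! ### Comultiplication, counit and evaluation -/

section ProdCoeff

variable {n : ℕ} {A : Type*} [Ring A] [Algebra ℂ A] {t t' : Idx n → Idx n → ℕ → A}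

/-- The two extreme terms of the convolution sum involve t^{(0)} = δ and give the linear part; in
the rest both superscripts are positive. This serves both for the comultiplication and for the
leading term of S. -/
theorem prodCoeff_succ_sub_mem (h : IsRTT t) (h' : IsRTT t') (M : Submodule ℂ A) (i j : Idx n)
    (r : ℕ) (hM : ∀ k p q, p + q + 1 = r → t' i k (p + 1) * t k j (q + 1) ∈ M) :
    prodCoeff t' t i j (r + 1) - (t' i j (r + 1) + t i j (r + 1)) ∈ M := by
  have e : ∀ k, ∑ p ∈ Finset.HasAntidiagonal.antidiagonal (r + 1), t' i k p.1 * t k j p.2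
      = (if i = k then t k j (r + 1) else 0) + (if k = j then t' i k (r + 1) else 0)
        + (∑ p ∈ Finset.HasAntidiagonal.antidiagonal r, t' i k (p.1 + 1) * t k j p.2
          - (if k = j then t' i k (r + 1) else 0)) := fun k => by
    rw [Finset.Nat.sum_antidiagonal_succ, h'.zero, ite_mul, one_mul, zero_mul]
    abel
  rw [prodCoeff, Finset.sum_congr rfl fun k _ => e k, Finset.sum_add_distrib,
    Finset.sum_add_distrib, Finset.sum_ite_eq, Finset.sum_ite_eq', if_pos (Finset.mem_univ _),
    if_pos (Finset.mem_univ _), add_comm (t i j (r + 1)), add_sub_cancel_left]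
  refine Submodule.sum_mem _ fun k _ => ?_
  rcases r with _ | r
  · simp [h.zero]
  · rw [Finset.Nat.sum_antidiagonal_succ', h.zero, mul_ite, mul_one, mul_zero,
      add_sub_cancel_left]
    exact Submodule.sum_mem _ fun p hp =>
      hM k _ _ (by have := Finset.HasAntidiagonal.mem_antidiagonal.1 hp; omega)

end ProdCoeff

/-- A universal solution of the RTT relations. -/
structure IsUniversalRTT {n : ℕ} {Y : Type} [Ring Y] [Algebra ℂ Y] (t : Idx n → Idx n → ℕ → Y) :
    Prop where
  isRTT : IsRTT t
  exists_lift : ∀ (A : Type) [Ring A] [Algebra ℂ A] (t' : Idx n → Idx n → ℕ → A), IsRTT t' →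
    ∃ f : Y →ₐ[ℂ] A, ∀ i j r, f (t i j r) = t' i j r

theorem isUniversalRTT_T (n : ℕ) : IsUniversalRTT (T (n := n)) where
  isRTT := isRTT_T n
  exists_lift _ _ _ t' h := ⟨yangianLift t' h, yangianLift_T t' h⟩

section Comul

variable {n : ℕ} {Y : Type} [Ring Y] [Algebra ℂ Y] {t : Idx n → Idx n → ℕ → Y}

/-- The generators of the Yangian, indexed so that `(i, j, r)` has weight `r`. -/
def wtGen (t : Idx n → Idx n → ℕ → Y) (a : Idx n × Idx n × ℕ) : Y := t a.1 a.2.1 (a.2.2 + 1)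

/-- The weight of a generator. -/
def wt (a : Idx n × Idx n × ℕ) : ℕ := a.2.2

theorem succ_mem_filt_wt (t : Idx n → Idx n → ℕ → Y) (i j : Idx n) (r : ℕ) :
    t i j (r + 1) ∈ filt (wtGen t) wt r :=
  mem_filt (f := wtGen t) (w := wt) (a := (i, j, r)) le_rfl

theorem exists_comul (h : IsUniversalRTT t) :
    ∃ Δ : Y →ₐ[ℂ] Y ⊗[ℂ] Y, ∀ i j (r : ℕ), Δ (t i j (r + 1)) - (t i j (r + 1) ⊗ₜ 1 + 1 ⊗ₜ t i j (r + 1))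
      ∈ filt₂ (wtGen t) wt (r - 1) := by
  have h₁ := h.isRTT.map
    (Algebra.TensorProduct.includeLeft (R := ℂ) (S := ℂ) (A := Y) (B := Y)).toRingHom
  have h₂ := h.isRTT.map
    (Algebra.TensorProduct.includeRight (R := ℂ) (A := Y) (B := Y)).toRingHom
  obtain ⟨Δ, hΔ⟩ := h.exists_lift _ _ (h₁.mul h₂ fun i j k l r s => by
    change (t i j r ⊗ₜ[ℂ] (1 : Y)) * ((1 : Y) ⊗ₜ[ℂ] t k l s)
      = ((1 : Y) ⊗ₜ[ℂ] t k l s) * (t i j r ⊗ₜ[ℂ] (1 : Y))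
    simp)
  refine ⟨Δ, fun i j r => ?_⟩
  rw [hΔ]
  refine prodCoeff_succ_sub_mem h₂ h₁ _ i j r fun k p q hpq => ?_
  change (t i k (p + 1) ⊗ₜ[ℂ] (1 : Y)) * ((1 : Y) ⊗ₜ[ℂ] t k j (q + 1)) ∈ _
  rw [Algebra.TensorProduct.tmul_mul_tmul, mul_one, one_mul]
  exact tmul_mem_filt₂ (succ_mem_filt_wt t i k p) (succ_mem_filt_wt t k j q) (by omega)

theorem comul_wtGen_mem {Δ : Y →ₐ[ℂ] Y ⊗[ℂ] Y}
    (hΔ : ∀ i j (r : ℕ), Δ (t i j (r + 1)) - (t i j (r + 1) ⊗ₜ 1 + 1 ⊗ₜ t i j (r + 1))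
      ∈ filt₂ (wtGen t) wt (r - 1)) (a : Idx n × Idx n × ℕ) :
    Δ (wtGen t a) ∈ filt₂ (wtGen t) wt (wt a) := by
  have h1 := filt₂_mono (E := a.2.2) (by omega) (hΔ a.1 a.2.1 a.2.2)
  have h2 := succ_mem_filt_wt t a.1 a.2.1 a.2.2
  have h3 := Submodule.add_mem _ h1 (Submodule.add_mem _
    (tmul_mem_filt₂ (D := a.2.2) h2 one_mem_filt (by omega))
    (tmul_mem_filt₂ (D := a.2.2) one_mem_filt h2 (by omega)))
  rwa [sub_add_cancel] at h3

end Comul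

section Evaluation

variable {n : ℕ} {Y P : Type} [Ring Y] [Algebra ℂ Y] [CommRing P] [Algebra ℂ P]
  {t : Idx n → Idx n → ℕ → Y}

theorem mem_degLE_of_filt {σ : Type*} {g : σ → Y} {w : σ → ℕ} {θ : Y →ₗ[ℂ] Polynomial P}
    (h : ∀ l : List σ, θ (l.map g).prod ∈ degLE P (l.map w).sum) (d : ℤ) (y : Y)
    (hy : y ∈ filt g w d) : θ y ∈ degLE P d := by
  induction hy using Submodule.span_induction with
  | mem y hy =>
    obtain ⟨l, hl, rfl⟩ := hy
    exact fun e he => h l e (by omega)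
  | zero => rw [map_zero]; exact Submodule.zero_mem _
  | add a b _ _ ha hb => rw [map_add]; exact Submodule.add_mem _ ha hb
  | smul c a _ ha => rw [map_smul]; exact Submodule.smul_mem _ _ ha

/-- The assignment t^{(r)} ↦ 0 for r ≥ 1 solves the RTT relations and kills every nonempty word in
the generators. -/
theorem exists_counit (h : IsUniversalRTT t) (P : Type) [CommRing P] [Algebra ℂ P] :
    ∃ ε : Y →ₗ[ℂ] Polynomial P, ε 1 = 1 ∧
      ∀ d, ∀ y ∈ filt (wtGen t) wt d, ε y ∈ degLE P d := by
  obtain ⟨ε, hε⟩ := h.exists_lift (Polynomial P) (fun i j r => if r = 0 ∧ i = j then 1 else 0)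
    ⟨fun i j => by simp, fun i j k l r s => by
      rcases r with _ | r <;> rcases s with _ | s <;> simp [mul_comm]⟩
  refine ⟨ε.toLinearMap, map_one ε, mem_degLE_of_filt fun l => ?_⟩
  rcases l with _ | ⟨a, l⟩
  · intro e he
    simp only [List.map_nil, List.sum_nil, List.prod_nil, AlgHom.toLinearMap_apply, map_one] at he ⊢
    rw [Polynomial.coeff_one, if_neg (by omega)]
  · simp [wtGen, hε]

/-- The evaluation of the generators at a variable, in the representation of `𝔤𝔩_n` on the sum of
the standard and the trivial one. -/
noncomputable def evalT (n : ℕ) (i j : Idx n) :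
    ℕ → Polynomial (Matrix (Option (Idx n)) (Option (Idx n)) ℂ)
  | 0 => if i = j then 1 else 0
  | r + 1 => Polynomial.monomial r (Matrix.single (some i) (some j) 1)

/-- For r, s ≥ 1 each term depends only on r + s and both sides vanish. If exactly one of r, s is 0,
the relation is the commutator of matrix units. -/
theorem isRTT_evalT (n : ℕ) : IsRTT (evalT n) where
  zero i j := rfl
  rel i j k l r s := by
    have hs : ∀ a b c d : Idx n, Matrix.single (some a) (some b) (1 : ℂ) *
        Matrix.single (some c) (some d) 1 = if b = c then Matrix.single (some a) (some d) 1
          else 0 := fun a b c d => by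
      split_ifs with hbc
      · rw [hbc, Matrix.single_mul_single_same, mul_one]
      · exact Matrix.single_mul_single_of_ne (h := fun e => hbc (Option.some.inj e)) ..
    rcases r with _ | r <;> rcases s with _ | s
    · simp only [evalT]; split_ifs <;> simp
    · simp only [evalT, zero_add, Polynomial.monomial_mul_monomial, hs, eq_comm (a := l) (b := i),
        eq_comm (a := k) (b := j)]
      split_ifs <;> simp
    · simp only [evalT, zero_add, Polynomial.monomial_mul_monomial, hs, eq_comm (a := l) (b := i),
        eq_comm (a := k) (b := j)]
      split_ifs <;> simp
    · simp only [evalT, Polynomial.monomial_mul_monomial, hs,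
        show r + 1 + s = r + (s + 1) by omega, show s + 1 + r = s + (r + 1) by omega,
        add_comm s r]
      simp

/-- The linear functional on matrices with values `γ` on the matrix units of the standard block that
vanishes on the identity matrix. -/
noncomputable def matFunctional (γ : Idx n → Idx n → P) :
    Matrix (Option (Idx n)) (Option (Idx n)) ℂ →ₗ[ℂ] P where
  toFun M := ∑ i, ∑ j, (M (some i) (some j) - if i = j then M none none else 0) • γ i j
  map_add' M N := by
    simp only [← Finset.sum_add_distrib, ← add_smul, Matrix.add_apply]
    refine Finset.sum_congr rfl fun i _ => Finset.sum_congr rfl fun j _ => ?_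
    split_ifs <;> congr 1 <;> ring
  map_smul' c M := by
    simp only [Finset.smul_sum, smul_smul, Matrix.smul_apply, RingHom.id_apply]
    refine Finset.sum_congr rfl fun i _ => Finset.sum_congr rfl fun j _ => ?_
    split_ifs <;> congr 1 <;> simp [mul_sub]

theorem matFunctional_apply (γ : Idx n → Idx n → P) (M : Matrix (Option (Idx n)) _ ℂ) :
    matFunctional γ M
      = ∑ i, ∑ j, (M (some i) (some j) - if i = j then M none none else 0) • γ i j := rfl

theorem matFunctional_one (γ : Idx n → Idx n → P) : matFunctional γ 1 = 0 := by
  rw [matFunctional_apply]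
  refine Finset.sum_eq_zero fun i _ => Finset.sum_eq_zero fun j _ => ?_
  simp [Matrix.one_apply]

theorem matFunctional_single (γ : Idx n → Idx n → P) (i j : Idx n) :
    matFunctional γ (Matrix.single (some i) (some j) 1) = γ i j := by
  rw [matFunctional_apply, Finset.sum_eq_single i, Finset.sum_eq_single j]
  · simp
  · intro b _ hb
    simp [hb.symm]
  · simp
  · intro b _ hb
    refine Finset.sum_eq_zero fun j' _ => ?_
    simp [hb.symm]
  · simp

/-- A word of weight D evaluates to a matrix times z^D, and the functional attached to γ(·, ·, D) is
applied to that matrix. The extra trivial summand of the representation makes the identity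
independent of the matrix units E_{i,j}, so ξ 1 = 0 is compatible with arbitrary values γ. -/
theorem exists_symbol (h : IsUniversalRTT t) (γ : Idx n → Idx n → ℕ → P) :
    ∃ ξ : Y →ₗ[ℂ] Polynomial P, ξ 1 = 0 ∧
      (∀ d, ∀ y ∈ filt (wtGen t) wt d, ξ y ∈ degLE P d) ∧
      ∀ i j r, (ξ (t i j (r + 1))).coeff r = γ i j r := by
  obtain ⟨f, hf⟩ := h.exists_lift _ _ (isRTT_evalT n)
  set θ : Polynomial (Matrix (Option (Idx n)) (Option (Idx n)) ℂ) →ₗ[ℂ] Polynomial P :=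
    Polynomial.lsum fun r => (Polynomial.monomial r).restrictScalars ℂ ∘ₗ
      matFunctional fun i j => γ i j r with hθ
  have hθm : ∀ r M, θ (Polynomial.monomial r M)
      = Polynomial.monomial r (matFunctional (fun i j => γ i j r) M) := fun r M => by
    rw [hθ, Polynomial.lsum_apply, Polynomial.sum_monomial_index _ _ (by simp)]
    rfl
  refine ⟨θ ∘ₗ f.toLinearMap, ?_, mem_degLE_of_filt fun l => ?_, fun i j r => ?_⟩
  · rw [LinearMap.comp_apply, AlgHom.toLinearMap_apply, map_one, ← Polynomial.monomial_zero_one,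
      hθm, matFunctional_one, map_zero]
  · have : ∃ M, f (l.map (wtGen t)).prod = Polynomial.monomial (l.map wt).sum M := by
      induction l with
      | nil => exact ⟨1, by simp⟩
      | cons a l ih =>
        obtain ⟨M, hM⟩ := ih
        simp only [List.map_cons, List.prod_cons, List.sum_cons, map_mul, hM, wtGen, hf, evalT,
          Polynomial.monomial_mul_monomial]
        exact ⟨_, rfl⟩
    obtain ⟨M, hM⟩ := this
    rw [LinearMap.comp_apply, AlgHom.toLinearMap_apply, hM, hθm]
    intro e he
    rw [Polynomial.coeff_monomial, if_neg (by omega)]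
  · rw [LinearMap.comp_apply, AlgHom.toLinearMap_apply, hf, evalT, hθm, matFunctional_single,
      Polynomial.coeff_monomial, if_pos rfl]

end Evaluation

end TwistedYangian

namespace TwistedYangian

open scoped TensorProduct

/-! ### Symbols of the generators of the twisted Yangian -/

section Symbols

variable {n : ℕ} {Y P : Type} [Ring Y] [Algebra ℂ Y] [CommRing P] [Algebra ℂ P]
  {t t' : Idx n → Idx n → ℕ → Y}

namespace IsPrim

variable {σ : Type*} {g : σ → Y} {w : σ → ℕ} {Δ : Y →ₐ[ℂ] Y ⊗[ℂ] Y} {ξ : Y →ₗ[ℂ] Polynomial P}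
  {d : ℕ} {f f' : P} {y y' : Y}

theorem add (h : IsPrim g w Δ ξ d f y) (h' : IsPrim g w Δ ξ d f' y') :
    IsPrim g w Δ ξ d (f + f') (y + y') where
  mem := Submodule.add_mem _ h.mem h'.mem
  comul := by
    have := Submodule.add_mem _ h.comul h'.comul
    rw [map_add, TensorProduct.add_tmul, TensorProduct.tmul_add]
    convert this using 1
    abel
  symbol := by rw [map_add, Polynomial.coeff_add, h.symbol, h'.symbol]

theorem smul (c : ℂ) (h : IsPrim g w Δ ξ d f y) : IsPrim g w Δ ξ d (c • f) (c • y) where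
  mem := Submodule.smul_mem _ _ h.mem
  comul := by
    have := Submodule.smul_mem _ c h.comul
    rwa [map_smul, ← TensorProduct.smul_tmul', TensorProduct.tmul_smul, ← smul_add, ← smul_sub]
  symbol := by rw [map_smul, Polynomial.coeff_smul, h.symbol]

/-- Terms of lower weight affect neither the comultiplication condition nor the symbol, so only
leading terms have to be examined. -/
theorem of_sub_mem (hΔ : ∀ a, Δ (g a) ∈ filt₂ g w (w a))
    (hξ : ∀ d, ∀ y ∈ filt g w d, ξ y ∈ degLE P d) (h : IsPrim g w Δ ξ d f y)
    (hy : y' - y ∈ filt g w (d - 1)) : IsPrim g w Δ ξ d f y' where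
  mem := by
    have := Submodule.add_mem _ (filt_mono (by omega) hy) h.mem
    rwa [sub_add_cancel] at this
  comul := by
    have h1 := Submodule.sub_mem _ (comul_mem_filt₂ hΔ hy) (Submodule.add_mem _
      (tmul_mem_filt₂ (D := d - 1) hy (one_mem_filt (f := g) (w := w)) (by omega))
      (tmul_mem_filt₂ (D := d - 1) (one_mem_filt (f := g) (w := w)) hy (by omega)))
    have h2 := Submodule.add_mem _ h1 h.comul
    rw [map_sub, TensorProduct.sub_tmul, TensorProduct.tmul_sub] at h2
    convert h2 using 1
    abel
  symbol := by
    have := hξ _ _ hy d (by omega)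
    rw [map_sub, Polynomial.coeff_sub, sub_eq_zero] at this
    rw [this, h.symbol]

end IsPrim

/-- The quadratic terms t^{(p+1)} t^{(q+1)} of S^{(r+1)} have p + q + 1 = r, hence weight r - 1;
what remains is the linear part. -/
theorem isPrim_prodCoeff {Δ : Y →ₐ[ℂ] Y ⊗[ℂ] Y} {ξ : Y →ₗ[ℂ] Polynomial P} {φ : ℤˣ}
    {γ : Idx n → Idx n → ℕ → P} (h : IsRTT t) (ht' : IsTwistedTranspose φ t t')
    (hΔ : ∀ i j (r : ℕ), Δ (t i j (r + 1)) - (t i j (r + 1) ⊗ₜ 1 + 1 ⊗ₜ t i j (r + 1))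
      ∈ filt₂ (wtGen t) wt (r - 1))
    (hξ : ∀ d, ∀ y ∈ filt (wtGen t) wt d, ξ y ∈ degLE P d)
    (hγ : ∀ i j r, (ξ (t i j (r + 1))).coeff r = γ i j r) (i j : Idx n) (r : ℕ) :
    IsPrim (wtGen t) wt Δ ξ r (((eps φ i * eps φ j * (-1) ^ (r + 1) : ℤ) : ℂ) • γ (-j) (-i) r
      + γ i j r) (prodCoeff t' t i j (r + 1)) := by
  have h1 : ∀ i j, IsPrim (wtGen t) wt Δ ξ r (γ i j r) (t i j (r + 1)) := fun i j =>
    ⟨succ_mem_filt_wt t i j r, hΔ i j r, hγ i j r⟩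
  have ht : ∀ i j r, t' i j r = ((eps φ i * eps φ j * (-1) ^ r : ℤ) : ℂ) • t (-j) (-i) r :=
    fun i j r => by rw [ht'.eq, Int.cast_smul_eq_zsmul ℂ]
  refine IsPrim.of_sub_mem (comul_wtGen_mem hΔ) hξ
    (((h1 (-j) (-i)).smul _).add (h1 i j)) ?_
  rw [← ht]
  refine prodCoeff_succ_sub_mem h ht'.isRTT _ i j r fun k p q hpq => ?_
  rw [ht, smul_mul_assoc]
  exact Submodule.smul_mem _ _ (mul_mem_filt' (succ_mem_filt_wt t _ _ p)
    (succ_mem_filt_wt t _ _ q) (by omega))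

open Classical in
/-- Symbols of the generators of the Yangian for which the symbols of the admissible generators of
the twisted Yangian are the variables. -/
noncomputable def admSymbol (n : ℕ) (φ : ℤˣ) (i j : Idx n) (r : ℕ) :
    MvPolynomial (AdmissibleTriple n φ) ℂ :=
  if h : ∃ a : AdmissibleTriple n φ, a.i = i ∧ a.j = j ∧ a.r = r + 1 then
    -- When i + j = 0 the triples for (i, j) and (-j, -i) coincide and the symbol is counted twice
    -- in the leading term of S.
    (if i.1 + j.1 = 0 then 1 / 2 else 1 : ℂ) • MvPolynomial.X h.choose else 0

theorem AdmissibleTriple.ext' {φ : ℤˣ} {a b : AdmissibleTriple n φ} (hi : a.i = b.i)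
    (hj : a.j = b.j) (hr : a.r = b.r) : a = b := by
  cases a; cases b; simp_all

theorem admSymbol_apply {φ : ℤˣ} (a : AdmissibleTriple n φ) {r : ℕ} (hr : a.r = r + 1) :
    admSymbol n φ a.i a.j r
      = (if a.i.1 + a.j.1 = 0 then 1 / 2 else 1 : ℂ) • MvPolynomial.X a := by
  have h : ∃ b : AdmissibleTriple n φ, b.i = a.i ∧ b.j = a.j ∧ b.r = r + 1 := ⟨a, rfl, rfl, hr⟩
  rw [admSymbol, dif_pos h]
  congr 2
  exact AdmissibleTriple.ext' h.choose_spec.1 h.choose_spec.2.1 (h.choose_spec.2.2.trans hr.symm)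

theorem AdmissibleTriple.add_le {φ : ℤˣ} (a : AdmissibleTriple n φ) : a.i.1 + a.j.1 ≤ 0 := by
  rcases Int.units_eq_one_or φ with h | h <;> rcases Nat.even_or_odd a.r with h' | h'
  exacts [a.plus_even h h', (a.plus_odd h h').le, (a.minus_even h h').le, a.minus_odd h h']

theorem AdmissibleTriple.sign_eq {φ : ℤˣ} (a : AdmissibleTriple n φ) (h0 : a.i.1 + a.j.1 = 0) :
    (φ : ℤ) * (-1) ^ a.r = 1 := by
  rcases Int.units_eq_one_or φ with h | h <;> rcases Nat.even_or_odd a.r with h' | h'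
  · rw [h'.neg_one_pow, h]; rfl
  · exact absurd (a.plus_odd h h') (by omega)
  · exact absurd (a.minus_even h h') (by omega)
  · rw [h'.neg_one_pow, h]; rfl

/-- For i + j < 0 the mirror pair has positive sum and symbol 0. For i + j = 0 the two summands
agree, and admissibility makes the sign +1, so the halves add up. -/
theorem admSymbol_add {φ : ℤˣ} (hφ : Odd n → φ = 1) (a : AdmissibleTriple n φ) {r : ℕ}
    (hr : a.r = r + 1) :
    ((eps φ a.i * eps φ a.j * (-1) ^ (r + 1) : ℤ) : ℂ) • admSymbol n φ (-a.j) (-a.i) r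
      + admSymbol n φ a.i a.j r = MvPolynomial.X a := by
  by_cases h0 : a.i.1 + a.j.1 = 0
  · have hj : a.j = -a.i := Subtype.ext (by rw [neg_val]; omega)
    have h1 : -a.j = a.i := by rw [hj, neg_neg]
    have hs : eps φ a.i * (φ * eps φ a.i) * (-1) ^ (r + 1) = 1 := by
      have := a.sign_eq h0
      rw [hr] at this
      linear_combination (φ * (-1) ^ (r + 1)) * eps_mul_self φ a.i + this
    rw [h1, ← hj, admSymbol_apply a hr, if_pos h0, hj, eps_neg hφ, hs, Int.cast_one]
    module
  · have h2 : admSymbol n φ (-a.j) (-a.i) r = 0 := by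
      rw [admSymbol, dif_neg]
      rintro ⟨b, hi, hj, -⟩
      have h3 := b.add_le
      have h4 := a.add_le
      rw [hi, hj, neg_val, neg_val] at h3
      omega
    rw [h2, smul_zero, zero_add, admSymbol_apply a hr, if_neg h0, one_smul]

theorem linearIndependent_admGen {φ : ℤˣ} (hφ : Odd n → φ = 1) (h : IsUniversalRTT t)
    (ht' : IsTwistedTranspose φ t t') [LinearOrder (AdmissibleTriple n φ)] :
    LinearIndependent ℂ fun m : AdmissibleTriple n φ →₀ ℕ =>
      ((m.support.sort (· ≤ ·)).map fun a => admGen φ t' t a ^ m a).prod := by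
  obtain ⟨Δ, hΔ⟩ := exists_comul h
  obtain ⟨ε, hε1, hε⟩ := exists_counit h (MvPolynomial (AdmissibleTriple n φ) ℂ)
  obtain ⟨ξ, hξ1, hξ, hγ⟩ := exists_symbol h (admSymbol n φ)
  -- The weight here is r - 1, one less than in the filtration used for spanning.
  refine linearIndependent_of_isPrim (d := fun a => a.r - 1) (comul_wtGen_mem hΔ) hε hξ hε1 hξ1
    fun a => ?_
  have hr : a.r = a.r - 1 + 1 := by have := a.one_le; omega
  have := isPrim_prodCoeff h.isRTT ht' hΔ hξ hγ a.i a.j (a.r - 1)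
  rwa [admSymbol_add hφ a hr, ← hr] at this

end Symbols

theorem linearIndependent_orderedMonomial {n : ℕ} {φ : ℤˣ} (hφ : Odd n → φ = 1)
    [LinearOrder (AdmissibleTriple n φ)] :
    LinearIndependent ℂ (orderedMonomial (n := n) (φ := φ)) := by
  have e : orderedMonomial (n := n) (φ := φ) = _ := funext orderedMonomial_eq
  rw [e]
  exact linearIndependent_admGen hφ (isUniversalRTT_T n) (isTwistedTranspose_tauT φ)

end TwistedYangian

/-! ### The basis theorem -/

theorem mainTheorem8 (n : ℕ) (hn : 1 ≤ n) (φ : ℤˣ) (hφ : Odd n → φ = 1)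
    [LinearOrder (TwistedYangian.AdmissibleTriple n φ)] :
    ∃ b : Module.Basis (TwistedYangian.AdmissibleTriple n φ →₀ ℕ) ℂ
        (TwistedYangian.twistedYangian n φ),
      ∀ m : TwistedYangian.AdmissibleTriple n φ →₀ ℕ,
        (b m : TwistedYangian.Yangian n) = TwistedYangian.orderedMonomial m := by
  set v : (TwistedYangian.AdmissibleTriple n φ →₀ ℕ) → TwistedYangian.twistedYangian n φ :=
    fun m => ⟨TwistedYangian.orderedMonomial m, TwistedYangian.orderedMonomial_mem m⟩
  have hli : LinearIndependent ℂ v := LinearIndependent.of_comp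
    (TwistedYangian.twistedYangian n φ).val.toLinearMap
    (TwistedYangian.linearIndependent_orderedMonomial hφ)
  have hsp : ⊤ ≤ Submodule.span ℂ (Set.range v) := by
    rintro ⟨x, hx⟩ -
    have h := TwistedYangian.mem_span_of_mem_twistedYangian hφ hx
    have e : Set.range (TwistedYangian.orderedMonomial (n := n) (φ := φ))
        = (TwistedYangian.twistedYangian n φ).val.toLinearMap '' Set.range v := by
      rw [← Set.range_comp]; rfl
    rw [e, Submodule.span_image] at h
    obtain ⟨z, hz, hzx⟩ := h
    have : z = ⟨x, hx⟩ := Subtype.ext hzx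
    rwa [← this]
  exact ⟨Module.Basis.mk hli hsp, fun m => by rw [Module.Basis.mk_apply]⟩
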